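/- Let $D=\{z\in\mathbb C:|z|<1\}$. Write $\mathcal{HK}$ for the set of $2\pi$-periodic functions $f:\mathbb R\to\mathbb R$ that are Henstock--Kurzweil integrable on every bounded interval and have finite Alexiewicz norm $$\|f\|:=\sup_I\Big|\int_I f\Big|,$$ where $I$ ranges over the intervals in $\mathbb R$ of length at most $2\pi$. For $0\le r<1$ let $\Phi_r(\theta)=\dfrac{1-r^2}{2\pi(1-2r\cos\theta+r^2)}$ be the Poisson kernel and, for $f\in\mathcal{HK}$, let $$P[f](re^{i\theta})=\int_{-\pi}^{\pi}f(\phi)\,\Phi_r(\phi-\theta)\,d\phi$$ (Henstock--Kurzweil integral) be the Poisson integral of $f$. For $u:D\to\mathbb R$ write $u_r(\theta)=u(re^{i\theta})$. **Theorem.** Let $u:D\to\mathbb R$ be harmonic in $D$ and suppose that there is $f\in\mathcal{HK}$ such that 1. $u_r(\theta)\to f(\theta)$ as $r\to1^-$ for each $\theta\in[-\pi,\pi)$, and 2. $\|u_r\|=o(1/(1-r))$ as $r\to1^-$, i.e. $(1-r)\|u_r\|\to0$. Then $u=P[f]$ in $D$; that is, for all $0\le r<1$ and $\theta\in\mathbb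 R$ the integral defining $P[f](re^{i\theta})$ exists and equals $u(re^{i\theta})$. -/

import Mathlib

open Set Filter Topology

noncomputable section

namespace HKDirichlet

/-- The interval from `a` to `b`, as a one-dimensional box. -/
def ivl (a b : ℝ) (h : a < b) : BoxIntegral.Box (Fin 1) :=
  ⟨fun _ => a, fun _ => b, fun _ => h⟩

/-- `f` is Henstock–Kurzweil integrable on the interval from `a` to `b`, where `a < b`. -/
def HKIntegrable (f : ℝ → ℝ) (a b : ℝ) : Prop :=
  ∃ h : a < b, BoxIntegral.Integrable (ivl a b h) BoxIntegral.IntegrationParams.Henstock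
    (fun x : Fin 1 → ℝ => f (x 0)) BoxIntegral.BoxAdditiveMap.volume

/-- The Henstock–Kurzweil integral of `f` from `a` to `b`, where `a < b`. It is only meaningful
when `HKIntegrable f a b` holds. -/
def hkIntegral (f : ℝ → ℝ) (a b : ℝ) : ℝ :=
  if h : a < b then
    BoxIntegral.integral (ivl a b h) BoxIntegral.IntegrationParams.Henstock
      (fun x : Fin 1 → ℝ => f (x 0)) BoxIntegral.BoxAdditiveMap.volume
  else 0

/-- The Alexiewicz norm on the circle: the supremum of the absolute values of the integrals of `f`
over the intervals of length at most `2π` (intervals of length zero contribute nothing).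
It is used for functions that are Henstock–Kurzweil integrable on every bounded interval. -/
def alexiewiczNorm (f : ℝ → ℝ) : ENNReal :=
  ⨆ (a : ℝ) (b : ℝ) (_ : a < b ∧ b - a ≤ 2 * Real.pi), ENNReal.ofReal |hkIntegral f a b|

/-- The class of `2π`-periodic functions `f : ℝ → ℝ` that are Henstock–Kurzweil integrable
(on every bounded interval), with finite Alexiewicz norm. -/
structure MemHK (f : ℝ → ℝ) : Prop where
  periodic : Function.Periodic f (2 * Real.pi)
  integrable : ∀ a b : ℝ, a < b → HKIntegrable f a b
  norm_finite : alexiewiczNorm f < ⊤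

/-- The Poisson kernel `Φ_r(θ)`. -/
def poissonKer (r θ : ℝ) : ℝ :=
  (1 - r ^ 2) / (2 * Real.pi * (1 - 2 * r * Real.cos θ + r ^ 2))

/-- The Poisson integral `P[f](r e^{iθ})`, as a Henstock–Kurzweil integral. -/
def poissonInt (f : ℝ → ℝ) (r θ : ℝ) : ℝ :=
  hkIntegral (fun φ => f φ * poissonKer r (φ - θ)) (-Real.pi) Real.pi

/-- The function `u_r(θ) = u(r e^{iθ})`. -/
def circleFun (u : ℂ → ℝ) (r θ : ℝ) : ℝ :=
  u ((r : ℂ) * Complex.exp ((θ : ℂ) * Complex.I))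

end HKDirichlet

end

/-!
Let `F` be a Henstock–Kurzweil primitive of `f`. For every `ε > 0` there is a monotone function `E`
of total variation at most `ε` such that `|f θ (y - x) - (F y - F x)| ≤ E y - E x` for all small
intervals `[x, y]` around `θ`. A Fatou argument then shows that the harmonic function
`w = u - P[dF] - P[dE]` has radial upper limits at most `0` at every boundary point, and it follows
that `w ≤ 0`; letting `ε → 0` gives `u ≤ P[dF]`. The same applied to `-u` and `-f` gives
`u = P[dF]`, and integrating by parts turns `P[dF]` into `P[f]`.

The maximum principle for `w` is not a boundary-value argument, because `w` is only known to be
`o((1 - |z|)⁻²)` near the boundary: the growth of the Alexiewicz norms gives no more, upon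
integrating the Poisson formula for `u` by parts. In the coordinate `z = e^{iζ}`, Baire's
theorem supplies, inside the set of boundary points near which `w` is not controlled, a portion at
which the radial bounds hold up to a common height. Over each gap of that portion Domar's estimate
turns the growth bound into one by the corner barrier, and a Phragmén–Lindelöf argument on the half
strip bounds `w` uniformly in the gap, so that the set of bad points is empty.
-/

noncomputable section

namespace HKDirichlet

open InnerProductSpace

/-! ### The maximum principle -/

theorem exists_analyticAt_re_eventuallyEq {g : ℂ → ℝ} {z : ℂ} (hg : HarmonicAt g z) :
    ∃ G : ℂ → ℂ, AnalyticAt ℂ G z ∧ (fun w => (G w).re) =ᶠ[𝓝 z] g := by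
  obtain ⟨ρ, hρ, hball⟩ := Metric.eventually_nhds_iff_ball.1 hg.eventually
  obtain ⟨G, hG, hGg⟩ := HarmonicOnNhd.exists_analyticOnNhd_ball_re_eq hball
  exact ⟨G, hG z (Metric.mem_ball_self hρ), hGg.eventuallyEq_of_mem (Metric.ball_mem_nhds z hρ)⟩

theorem harmonicAt_comp_of_analyticAt {g : ℂ → ℝ} {h : ℂ → ℂ} {z : ℂ} (hg : HarmonicAt g (h z))
    (hh : AnalyticAt ℂ h z) : HarmonicAt (g ∘ h) z := by
  obtain ⟨G, hG, hGg⟩ := exists_analyticAt_re_eventuallyEq hg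
  exact (harmonicAt_congr_nhds (hGg.comp_tendsto hh.continuousAt)).1 (hG.comp hh).harmonicAt_re

theorem eventuallyEq_of_isLocalMax_of_harmonicAt {g : ℂ → ℝ} {z : ℂ} (hg : HarmonicAt g z)
    (hmax : IsLocalMax g z) : ∀ᶠ w in 𝓝 z, g w = g z := by
  obtain ⟨G, hG, hGg⟩ := exists_analyticAt_re_eventuallyEq hg
  have hexp : ∀ᶠ w in 𝓝 z, DifferentiableAt ℂ (fun q => Complex.exp (G q)) w :=
    hG.eventually_analyticAt.mono fun w hw => hw.differentiableAt.cexp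
  have hexp_max : IsLocalMax (norm ∘ fun q => Complex.exp (G q)) z := by
    filter_upwards [hmax, hGg] with w hw hGw
    simpa only [Function.comp, Complex.norm_exp, hGw, hGg.self_of_nhds, Real.exp_le_exp] using hw
  filter_upwards [Complex.norm_eventually_eq_of_isLocalMax hexp hexp_max, hGg] with w hw hGw
  simpa only [Complex.norm_exp, hGw, hGg.self_of_nhds, Real.exp_eq_exp] using hw

theorem nonpos_of_harmonicAt_of_pos {K : Set ℂ} (hK : IsCompact K) {g : ℂ → ℝ}
    (hg : ContinuousOn g K) (hpos : ∀ z ∈ K, 0 < g z → K ∈ 𝓝 z ∧ HarmonicAt g z) :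
    ∀ z ∈ K, g z ≤ 0 := by
  intro z hz
  by_contra! hgz
  obtain ⟨z₀, hz₀, hmax⟩ := hK.exists_isMaxOn ⟨z, hz⟩ hg
  have hlevel : IsCompact (K ∩ g ⁻¹' {g z₀}) :=
    hK.of_isClosed_subset (hg.preimage_isClosed_of_isClosed hK.isClosed isClosed_singleton)
      inter_subset_left
  -- `g` is constant near a rightmost maximum point, which is absurd.
  obtain ⟨z₁, ⟨hz₁, hgz₁⟩, hre⟩ :=
    hlevel.exists_isMaxOn ⟨z₀, hz₀, rfl⟩ Complex.continuous_re.continuousOn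
  replace hgz₁ : g z₁ = g z₀ := hgz₁
  obtain ⟨hKz₁, hharm⟩ := hpos z₁ hz₁ (hgz₁ ▸ hgz.trans_le (hmax hz))
  have hconst : ∀ᶠ w in 𝓝 z₁, g w = g z₁ := eventuallyEq_of_isLocalMax_of_harmonicAt hharm <| by
    filter_upwards [hKz₁] with w hw using hgz₁ ▸ hmax hw
  have hright : Tendsto (fun t : ℝ => z₁ + t) (𝓝[>] 0) (𝓝 z₁) := by
    have : Tendsto (fun t : ℝ => z₁ + t) (𝓝 0) (𝓝 (z₁ + (0 : ℝ))) :=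
      Continuous.tendsto (by fun_prop) 0
    simpa using this.mono_left nhdsWithin_le_nhds
  obtain ⟨t, ⟨hgt, hKt⟩, ht⟩ :=
    ((hright.eventually (hconst.and hKz₁)).and self_mem_nhdsWithin).exists
  have hle : (z₁ + t : ℂ).re ≤ z₁.re := hre ⟨hKt, hgt.trans hgz₁⟩
  rw [Complex.add_re, Complex.ofReal_re] at hle
  linarith

theorem le_of_harmonicAt_of_lt {K : Set ℂ} (hK : IsCompact K) {s h : ℂ → ℝ}
    (hs : ContinuousOn s K) (hh : ContinuousOn h K)
    (hlt : ∀ z ∈ K, h z < s z → K ∈ 𝓝 z ∧ HarmonicAt s z ∧ HarmonicAt h z) :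
    ∀ z ∈ K, s z ≤ h z := fun z hz =>
  sub_nonpos.1 <| nonpos_of_harmonicAt_of_pos hK (hs.sub hh)
    (fun w hw hw0 =>
      have ⟨hKw, hsw, hhw⟩ := hlt w hw (sub_pos.1 hw0)
      ⟨hKw, hsw.sub hhw⟩) z hz

theorem reProdIm_Icc_mem_nhds {a b c d : ℝ} {z : ℂ} (hre : z.re ∈ Ioo a b) (him : z.im ∈ Ioo c d) :
    Icc a b ×ℂ Icc c d ∈ 𝓝 z :=
  mem_of_superset ((isOpen_Ioo.reProdIm isOpen_Ioo).mem_nhds ⟨hre, him⟩)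
    (Complex.reProdIm_subset_iff.2 (prod_mono Ioo_subset_Icc_self Ioo_subset_Icc_self))

/-! ### Domar's estimate -/

theorem le_of_forall_le_two_mul_of_box {s : ℂ → ℝ} {x₀ n M : ℝ} (hn : 0 < n) (hM : 0 ≤ M)
    (hc : ContinuousOn s (Icc (x₀ - 3 * n) (x₀ + 3 * n) ×ℂ Icc 0 n))
    (hbound : ∀ z ∈ Icc (x₀ - 3 * n) (x₀ + 3 * n) ×ℂ Icc 0 n, s z ≤ 2 * M)
    (hbot : ∀ z ∈ Icc (x₀ - 3 * n) (x₀ + 3 * n) ×ℂ Icc 0 n, z.im = 0 → s z ≤ 0)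
    (htop : ∀ z ∈ Icc (x₀ - 3 * n) (x₀ + 3 * n) ×ℂ Icc 0 n, z.im = n → s z ≤ M / 2)
    (hharm : ∀ z ∈ Icc (x₀ - 3 * n) (x₀ + 3 * n) ×ℂ Icc 0 n, 0 < s z → HarmonicAt s z) :
    ∀ z ∈ Icc (x₀ - 3 * n) (x₀ + 3 * n) ×ℂ Icc 0 n, z.re = x₀ → s z ≤ 13 / 18 * M := by
  set c := 2 * M / (9 * n ^ 2) with hc_def
  have hcn : c * (9 * n ^ 2) = 2 * M := by rw [hc_def]; field_simp
  have hc0 : 0 ≤ c := by positivity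
  set barrier : ℂ → ℝ := fun z => M / 2 + c * ((z.re - x₀) ^ 2 - z.im ^ 2 + n ^ 2) with hbarrier
  have hbarrier_harm (z : ℂ) : HarmonicAt barrier z := by
    convert AnalyticAt.harmonicAt_re (x := z) (f := fun q =>
      ((M / 2 : ℝ) : ℂ) + (c : ℂ) * ((q - (x₀ : ℂ)) ^ 2 + ((n ^ 2 : ℝ) : ℂ)))
      (Differentiable.analyticAt (by fun_prop) z) using 2 with q
    simp only [hbarrier, sq, Complex.add_re, Complex.mul_re, Complex.sub_re, Complex.sub_im,
      Complex.ofReal_re, Complex.ofReal_im]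
    ring
  have hle := le_of_harmonicAt_of_lt (isCompact_Icc.reProdIm isCompact_Icc) hc
    (show ContinuousOn barrier _ from Continuous.continuousOn (by fun_prop)) fun z hz hlt => by
      obtain ⟨⟨hz1, hz2⟩, hz3, hz4⟩ := id hz
      have hhalf : M / 2 ≤ barrier z := by
        have : 0 ≤ (z.re - x₀) ^ 2 - z.im ^ 2 + n ^ 2 := by nlinarith [sq_nonneg (z.re - x₀)]
        exact le_add_of_nonneg_right (by positivity)
      have hside : (z.re - x₀) ^ 2 ≠ (3 * n) ^ 2 := fun heq => by
        have : 2 * M ≤ barrier z := by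
          simp only [hbarrier, heq]
          nlinarith [mul_nonneg hc0 (sub_nonneg.2 (pow_le_pow_left₀ hz3 hz4 2))]
        linarith [hbound z hz]
      refine ⟨reProdIm_Icc_mem_nhds
        ⟨hz1.lt_of_ne fun h => hside (by rw [← h]; ring),
          hz2.lt_of_ne fun h => hside (by rw [h]; ring)⟩
        ⟨hz3.lt_of_ne fun h => ?_, hz4.lt_of_ne fun h => ?_⟩, hharm z hz (by linarith),
        hbarrier_harm z⟩
      · linarith [hbot z hz h.symm]
      · linarith [htop z hz h]
  intro z hz hzx
  calc s z ≤ M / 2 + c * ((z.re - x₀) ^ 2 - z.im ^ 2 + n ^ 2) := hle z hz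
    _ ≤ M / 2 + c * n ^ 2 := by rw [hzx]; gcongr; nlinarith [sq_nonneg z.im]
    _ = 13 / 18 * M := by linarith

/- The point `z₀` maximizes `s z * (R - |re z - x₀|) ^ 2`; this is Domar's replacement of a large
value by one that nearly dominates `s` on the scale `d` on which it is large. -/
theorem exists_dominating_of_lt_mul_sq {s : ℂ → ℝ} {x₀ R a b C : ℝ} (hR : 0 < R) (hC : 0 ≤ C)
    (hc : ContinuousOn s (Icc (x₀ - R) (x₀ + R) ×ℂ Icc a b)) {z : ℂ} (hz : z.im ∈ Icc a b)
    (hzx : z.re = x₀) (hlt : C < s z * R ^ 2) :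
    ∃ z₀ : ℂ, ∃ d : ℝ, 0 < d ∧ d ≤ R ∧ z₀.im ∈ Icc a b ∧ C < s z₀ * d ^ 2 ∧
      ∀ w : ℂ, |w.re - z₀.re| ≤ d / 4 → w.im ∈ Icc a b →
        w ∈ Icc (x₀ - R) (x₀ + R) ×ℂ Icc a b ∧ s w ≤ 2 * s z₀ := by
  have hzB : z ∈ Icc (x₀ - R) (x₀ + R) ×ℂ Icc a b := ⟨⟨by linarith, by linarith⟩, hz⟩
  obtain ⟨z₀, hz₀, hmax⟩ := (isCompact_Icc.reProdIm isCompact_Icc).exists_isMaxOn ⟨z, hzB⟩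
    (hc.mul (Continuous.continuousOn (f := fun w : ℂ => (R - |w.re - x₀|) ^ 2) (by fun_prop)))
  set d := R - |z₀.re - x₀| with hd
  have hCd : C < s z₀ * d ^ 2 := hlt.trans_le (by simpa [hzx] using hmax hzB)
  have hd0 : 0 ≤ d := sub_nonneg.2 (abs_le.2 ⟨by linarith [hz₀.1.1], by linarith [hz₀.1.2]⟩)
  have hdpos : 0 < d := hd0.lt_of_ne fun h => by rw [← h] at hCd; linarith
  have hs₀ : 0 < s z₀ := pos_of_mul_pos_left (hC.trans_lt hCd) (by positivity)
  refine ⟨z₀, d, hdpos, sub_le_self _ (abs_nonneg _), hz₀.2, hCd, fun w hw him => ?_⟩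
  have hdist : 3 / 4 * d ≤ R - |w.re - x₀| := by
    linarith [abs_sub_le w.re z₀.re x₀, hd]
  have hwB : w ∈ Icc (x₀ - R) (x₀ + R) ×ℂ Icc a b := by
    have := abs_le.1 (show |w.re - x₀| ≤ R by linarith)
    exact ⟨⟨by linarith, by linarith⟩, him⟩
  refine ⟨hwB, not_lt.1 fun hlt => ?_⟩
  have hw0 : 2 * s z₀ * (3 / 4 * d) ^ 2 ≤ s z₀ * d ^ 2 := calc
    _ ≤ s w * (R - |w.re - x₀|) ^ 2 := by gcongr; linarith
    _ ≤ s z₀ * d ^ 2 := hmax hwB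
  nlinarith [mul_pos hs₀ (pow_pos hdpos 2)]

theorem le_of_le_div_im_sq {s : ℂ → ℝ} {x₀ R ε : ℝ} (hR : 0 < R) (hε : 0 < ε)
    (hc : ContinuousOn s (Icc (x₀ - R) (x₀ + R) ×ℂ Icc 0 (2 * R)))
    (hbot : ∀ z ∈ Icc (x₀ - R) (x₀ + R) ×ℂ Icc 0 (2 * R), z.im = 0 → s z ≤ 0)
    (hharm : ∀ z ∈ Icc (x₀ - R) (x₀ + R) ×ℂ Icc 0 (2 * R), 0 < s z → HarmonicAt s z)
    (hgrowth : ∀ z ∈ Icc (x₀ - R) (x₀ + R) ×ℂ Icc 0 (2 * R), 0 < z.im → s z ≤ ε / z.im ^ 2)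
    {z : ℂ} (hz : z.im ∈ Icc 0 (2 * R)) (hzx : z.re = x₀) : s z ≤ 288 * ε / R ^ 2 := by
  by_contra! hlt
  rw [div_lt_iff₀ (by positivity)] at hlt
  obtain ⟨z₀, d, hd, hdR, him₀, hlarge, hdom⟩ :=
    exists_dominating_of_lt_mul_sq hR (by positivity) hc hz hzx hlt
  obtain ⟨hz₀, -⟩ := hdom z₀ (by rw [sub_self, abs_zero]; positivity) him₀
  have hs₀ : 0 < s z₀ := pos_of_mul_pos_left (lt_trans (by positivity) hlarge) (by positivity)
  -- At height `n` the growth bound is half of `s z₀`, and `z₀` lies below that height.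
  obtain ⟨n, hn, hns⟩ : ∃ n : ℝ, 0 < n ∧ s z₀ * n ^ 2 = 2 * ε :=
    ⟨√(2 * ε / s z₀), by positivity, by rw [Real.sq_sqrt (by positivity)]; field_simp⟩
  have hnd : 12 * n < d := by
    refine lt_of_pow_lt_pow_left₀ 2 hd.le (lt_of_mul_lt_mul_left ?_ hs₀.le)
    linarith
  have hbox : ∀ w ∈ Icc (z₀.re - 3 * n) (z₀.re + 3 * n) ×ℂ Icc 0 n,
      w ∈ Icc (x₀ - R) (x₀ + R) ×ℂ Icc 0 (2 * R) ∧ s w ≤ 2 * s z₀ := fun w hw =>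
    hdom w (abs_le.2 ⟨by linarith [hw.1.1], by linarith [hw.1.2]⟩)
      ⟨hw.2.1, by linarith [hw.2.2]⟩
  have hz₀im : 0 < z₀.im := him₀.1.lt_of_ne fun h => (hbot z₀ hz₀ h.symm).not_gt hs₀
  have hz₀n : z₀.im < n := by
    have := hgrowth z₀ hz₀ hz₀im
    rw [le_div_iff₀ (by positivity)] at this
    exact lt_of_pow_lt_pow_left₀ 2 hn.le (lt_of_mul_lt_mul_left (by linarith) hs₀.le)
  have := le_of_forall_le_two_mul_of_box hn hs₀.le (hc.mono fun w hw => (hbox w hw).1)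
    (fun w hw => (hbox w hw).2) (fun w hw => hbot w (hbox w hw).1)
    (fun w hw hwn => (hgrowth w (hbox w hw).1 (hwn ▸ hn)).trans (by
      rw [hwn, div_le_iff₀ (by positivity)]; linarith))
    (fun w hw => hharm w (hbox w hw).1) z₀ ⟨⟨by linarith, by linarith⟩, him₀.1, hz₀n.le⟩ rfl
  linarith

/-! ### A Phragmén–Lindelöf principle for half strips -/

/-- The real part of `i / w ^ 2`, a harmonic function off the origin that is positive on the open
first quadrant, vanishes on its sides, and has the critical growth `‖w‖⁻²` at its corner. -/
def quadrantBarrier (w : ℂ) : ℝ :=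
  (Complex.I / w ^ 2).re

theorem quadrantBarrier_apply (w : ℂ) :
    quadrantBarrier w = 2 * w.re * w.im / (w.re ^ 2 + w.im ^ 2) ^ 2 := by
  have hnorm : Complex.normSq (w ^ 2) = (w.re ^ 2 + w.im ^ 2) ^ 2 := by
    rw [map_pow, Complex.normSq_apply]; ring
  rw [quadrantBarrier, Complex.div_re, hnorm, sq w]
  simp only [Complex.I_re, Complex.I_im, Complex.mul_im, zero_mul, zero_div, zero_add, one_mul]
  ring

theorem harmonicAt_quadrantBarrier {w : ℂ} (hw : w ≠ 0) : HarmonicAt quadrantBarrier w :=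
  (analyticAt_const.div (analyticAt_id.pow 2) (pow_ne_zero 2 hw)).harmonicAt_re

theorem abs_quadrantBarrier_le (w : ℂ) : |quadrantBarrier w| ≤ 1 / ‖w‖ ^ 2 :=
  (Complex.abs_re_le_norm _).trans_eq (by simp)

theorem one_div_le_abs_quadrantBarrier {w : ℂ} {t : ℝ} (ht : 0 < t)
    (hre : |w.re| ∈ Icc t (2 * t)) (him : |w.im| ∈ Icc t (2 * t)) :
    1 / (32 * t ^ 2) ≤ |quadrantBarrier w| := by
  obtain ⟨⟨hX, hX'⟩, hY, hY'⟩ := And.intro hre him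
  have hsum : w.re ^ 2 + w.im ^ 2 ≤ 8 * t ^ 2 := by
    rw [← sq_abs w.re, ← sq_abs w.im]; nlinarith
  have hpos : 0 < w.re ^ 2 + w.im ^ 2 := by
    rw [← sq_abs w.re, ← sq_abs w.im]; nlinarith
  calc 1 / (32 * t ^ 2) = 2 * t * t / (8 * t ^ 2) ^ 2 := by field_simp; norm_num
    _ ≤ 2 * |w.re| * |w.im| / (w.re ^ 2 + w.im ^ 2) ^ 2 := by gcongr
    _ = |quadrantBarrier w| := by
      rw [quadrantBarrier_apply, abs_div, abs_mul, abs_mul, abs_of_pos (pow_pos hpos 2),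
        abs_of_pos (zero_lt_two' ℝ)]

/-- The sum of the quadrant barriers for the two corners of a half strip over `[a, b]`, with their
singularities moved by `τ` out of the half strip along the diagonals. -/
def cornerBarrier (a b τ : ℝ) (z : ℂ) : ℝ :=
  quadrantBarrier (z - ⟨a - τ, -τ⟩) - quadrantBarrier (z - ⟨b + τ, -τ⟩)

section cornerBarrier

variable {a b τ : ℝ} {z : ℂ}

theorem harmonicAt_cornerBarrier (hz : -τ < z.im) : HarmonicAt (cornerBarrier a b τ) z := by
  have hterm (p : ℂ) (hp : p.im = -τ) : HarmonicAt (quadrantBarrier ∘ fun w => w - p) z := by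
    refine harmonicAt_comp_of_analyticAt (harmonicAt_quadrantBarrier fun h => ?_)
      (analyticAt_id.sub analyticAt_const)
    have := congrArg Complex.im h
    simp only [Complex.sub_im, Complex.zero_im] at this
    linarith
  exact (hterm ⟨a - τ, -τ⟩ rfl).sub (hterm ⟨b + τ, -τ⟩ rfl)

theorem cornerBarrier_eq_abs_add_abs (hτ : 0 ≤ τ) (hre : z.re ∈ Icc a b) (him : 0 ≤ z.im) :
    cornerBarrier a b τ z =
      |quadrantBarrier (z - ⟨a - τ, -τ⟩)| + |quadrantBarrier (z - ⟨b + τ, -τ⟩)| := by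
  have hX := hre.1
  have hX' := hre.2
  rw [cornerBarrier, abs_of_nonneg, abs_of_nonpos, sub_eq_add_neg] <;>
    rw [quadrantBarrier_apply, Complex.sub_re, Complex.sub_im]
  · refine div_nonpos_of_nonpos_of_nonneg ?_ (by positivity)
    exact mul_nonpos_of_nonpos_of_nonneg (by linarith) (by linarith)
  · refine div_nonneg ?_ (by positivity)
    exact mul_nonneg (by linarith) (by linarith)

theorem cornerBarrier_le (hτ : 0 ≤ τ) (hre : z.re ∈ Icc a b) (him : 0 < z.im) :
    cornerBarrier a b τ z ≤ 2 / z.im ^ 2 := by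
  have hterm (x : ℝ) : |quadrantBarrier (z - ⟨x, -τ⟩)| ≤ 1 / z.im ^ 2 := by
    refine (abs_quadrantBarrier_le _).trans ?_
    gcongr
    calc z.im ≤ (z - ⟨x, -τ⟩).im := by rw [Complex.sub_im]; linarith
      _ ≤ ‖z - ⟨x, -τ⟩‖ := (le_abs_self _).trans (Complex.abs_im_le_norm _)
  calc cornerBarrier a b τ z ≤ 1 / z.im ^ 2 + 1 / z.im ^ 2 :=
        (cornerBarrier_eq_abs_add_abs hτ hre him.le).trans_le (add_le_add (hterm _) (hterm _))
    _ = 2 / z.im ^ 2 := by ring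

theorem one_div_le_cornerBarrier (hτ : 0 < τ) (hre : z.re ∈ Icc a b) (him : z.im ∈ Icc 0 τ)
    (hcorner : z.re ≤ a + τ ∨ b - τ ≤ z.re) : 1 / (32 * τ ^ 2) ≤ cornerBarrier a b τ z := by
  obtain ⟨⟨hX, hX'⟩, hY, hY'⟩ := And.intro hre him
  have him' (x : ℝ) : |(z - ⟨x, -τ⟩).im| ∈ Icc τ (2 * τ) := by
    rw [Complex.sub_im, abs_of_nonneg (by linarith)]
    constructor <;> linarith
  rw [cornerBarrier_eq_abs_add_abs hτ.le hre him.1]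
  rcases hcorner with h | h
  · refine le_add_of_le_of_nonneg (one_div_le_abs_quadrantBarrier hτ ?_ (him' _)) (abs_nonneg _)
    rw [Complex.sub_re, abs_of_nonneg (by linarith)]
    constructor <;> linarith
  · refine le_add_of_nonneg_of_le (abs_nonneg _) (one_div_le_abs_quadrantBarrier hτ ?_ (him' _))
    rw [Complex.sub_re, abs_of_nonpos (by linarith)]
    constructor <;> linarith

end cornerBarrier

/-- The positive part of `W - c` on `S`, extended by zero. -/
def excess (W : ℂ → ℝ) (S : Set ℂ) (c : ℝ) : ℂ → ℝ :=
  S.indicator fun z => max (W z - c) 0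

section excess

variable {W : ℂ → ℝ} {S : Set ℂ} {c : ℝ} {z : ℂ}

theorem sub_le_excess (hz : z ∈ S) : W z - c ≤ excess W S c z := by
  rw [excess, indicator_of_mem hz]
  exact le_max_left _ _

theorem excess_le {B : ℝ} (hB : 0 ≤ B) (hW : z ∈ S → W z ≤ c + B) : excess W S c z ≤ B := by
  by_cases hz : z ∈ S
  · rw [excess, indicator_of_mem hz]
    exact max_le (by linarith [hW hz]) hB
  · rwa [excess, indicator_of_notMem hz]

theorem excess_nonneg : 0 ≤ excess W S c z :=
  indicator_nonneg (fun _ _ => le_max_right _ _) z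

theorem mem_and_lt_of_excess_pos (hz : 0 < excess W S c z) : z ∈ S ∧ c < W z := by
  by_contra! h
  exact hz.not_ge (excess_le le_rfl fun hS => by simpa using h hS)

theorem continuousAt_excess_of_isOpen (hS : IsOpen S) (hz : z ∈ S) (hW : ContinuousAt W z) :
    ContinuousAt (excess W S c) z := by
  have : ContinuousAt (fun w => max (W w - c) 0) z :=
    (hW.sub continuousAt_const).max continuousAt_const
  refine this.congr ?_
  filter_upwards [hS.mem_nhds hz] with w hw using
    (indicator_of_mem hw fun w => max (W w - c) 0).symm

theorem continuousAt_excess_of_eventually_le (hW : ∀ᶠ w in 𝓝 z, w ∈ S → W w ≤ c) :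
    ContinuousAt (excess W S c) z := by
  refine (continuousAt_const (y := (0 : ℝ))).congr ?_
  filter_upwards [hW] with w hw
  exact le_antisymm excess_nonneg (excess_le le_rfl fun hwS => (hw hwS).trans_eq (add_zero c).symm)

theorem harmonicAt_excess (hS : IsOpen S) (hW : HarmonicAt W z) (hz : 0 < excess W S c z) :
    HarmonicAt (excess W S c) z := by
  obtain ⟨hzS, hcW⟩ := mem_and_lt_of_excess_pos hz
  refine (harmonicAt_congr_nhds ?_).1 (hW.sub (harmonicAt_const c))
  filter_upwards [hS.mem_nhds hzS, hW.1.continuousAt.eventually_const_lt hcW] with w hw hcw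
  rw [excess, indicator_of_mem hw, max_eq_left (sub_nonneg.2 hcw.le)]
  rfl

end excess

section halfStrip

variable {a b Y C : ℝ}

section rectangle

variable {s : ℂ → ℝ} {τ ε : ℝ}

theorem le_div_sq_of_rectangle (hτ : 0 < τ) (hτY : τ ≤ Y) (hε : 0 < ε)
    (hc : ContinuousOn s ((Icc a b ×ℂ Icc 0 Y) \ {(a : ℂ), (b : ℂ)}))
    (hside : ∀ z ∈ Icc a b ×ℂ Icc 0 Y, z ∉ Ioo a b ×ℂ Ioi 0 → s z ≤ 0)
    (hharm : ∀ z ∈ Icc a b ×ℂ Icc 0 Y, 0 < s z → HarmonicAt s z)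
    (hgrowth : ∀ z ∈ Icc a b ×ℂ Icc 0 Y, z.im ∈ Ioc 0 τ → s z ≤ ε / z.im ^ 2)
    {z : ℂ} (hz : z ∈ Icc (a + τ) (b - τ) ×ℂ Icc 0 τ) : s z ≤ 1152 * ε / τ ^ 2 := by
  obtain ⟨⟨hza, hzb⟩, hz0, hzτ⟩ := hz
  have hbox : Icc (z.re - τ / 2) (z.re + τ / 2) ×ℂ Icc 0 (2 * (τ / 2)) ⊆
      Ioo a b ×ℂ Icc 0 τ := fun w hw =>
    ⟨⟨by linarith [hw.1.1], by linarith [hw.1.2]⟩, hw.2.1, by linarith [hw.2.2]⟩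
  have hrect : Ioo a b ×ℂ Icc 0 τ ⊆ Icc a b ×ℂ Icc 0 Y := fun w hw =>
    ⟨Ioo_subset_Icc_self hw.1, hw.2.1, hw.2.2.trans hτY⟩
  have hle := le_of_le_div_im_sq (s := s) (z := z) (R := τ / 2) (half_pos hτ) hε
    (hc.mono fun w hw => ⟨hrect (hbox hw), ?_⟩)
    (fun w hw him => hside w (hrect (hbox hw)) fun h => h.2.ne' him)
    (fun w hw => hharm w (hrect (hbox hw)))
    (fun w hw him => hgrowth w (hrect (hbox hw)) ⟨him, (hbox hw).2.2⟩)
    ⟨hz0, by linarith⟩ rfl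
  · calc s z ≤ 288 * ε / (τ / 2) ^ 2 := hle
      _ = 1152 * ε / τ ^ 2 := by field_simp; norm_num
  · have hre := (hbox hw).1
    rintro (rfl | rfl)
    exacts [hre.1.ne' (Complex.ofReal_re _), hre.2.ne (Complex.ofReal_re _)]

/-- The rectangle `[a, b] × [0, Y]` without half-open squares of side `τ` at its lower corners. -/
def notchedRectangle (a b Y τ : ℝ) : Set ℂ :=
  (Icc (a + τ) (b - τ) ×ℂ Icc 0 Y) ∪ (Icc a b ×ℂ Icc τ Y)

theorem isCompact_notchedRectangle : IsCompact (notchedRectangle a b Y τ) :=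
  (isCompact_Icc.reProdIm isCompact_Icc).union (isCompact_Icc.reProdIm isCompact_Icc)

theorem notchedRectangle_subset (hτ : 0 < τ) :
    notchedRectangle a b Y τ ⊆ (Icc a b ×ℂ Icc 0 Y) \ {(a : ℂ), (b : ℂ)} := by
  refine fun w hw => ⟨?_, ?_⟩
  · rcases hw with hw | hw
    · exact ⟨⟨by linarith [hw.1.1], by linarith [hw.1.2]⟩, hw.2⟩
    · exact ⟨hw.1, hτ.le.trans hw.2.1, hw.2.2⟩
  · rintro (rfl | rfl) <;> rcases hw with ⟨⟨h1, h2⟩, -⟩ | ⟨-, h3, -⟩ <;>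
      simp only [Complex.ofReal_re, Complex.ofReal_im] at * <;> linarith

theorem le_of_notchedRectangle {h : ℂ → ℝ}
    (hs : ContinuousOn s (notchedRectangle a b Y τ))
    (hs_harm : ∀ z ∈ notchedRectangle a b Y τ, 0 < s z → HarmonicAt s z)
    (hh_harm : ∀ z ∈ notchedRectangle a b Y τ, HarmonicAt h z)
    (hh : ∀ z ∈ notchedRectangle a b Y τ, 0 ≤ h z)
    (hside : ∀ z ∈ notchedRectangle a b Y τ, z ∉ Ioo a b ×ℂ Ioi 0 → s z ≤ 0)
    (htop : ∀ z ∈ notchedRectangle a b Y τ, z.im = Y → s z ≤ h z)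
    (hnotch : ∀ z ∈ notchedRectangle a b Y τ, z.im ≤ τ → z.re ≤ a + τ ∨ b - τ ≤ z.re →
      s z ≤ h z) :
    ∀ z ∈ notchedRectangle a b Y τ, s z ≤ h z := by
  refine le_of_harmonicAt_of_lt isCompact_notchedRectangle hs
    (fun z hz => (hh_harm z hz).1.continuousAt.continuousWithinAt) fun z hz hlt => ?_
  have hsz : 0 < s z := (hh z hz).trans_lt hlt
  refine ⟨?_, hs_harm z hz hsz, hh_harm z hz⟩
  obtain ⟨hre, him⟩ : z ∈ Ioo a b ×ℂ Ioi 0 := not_not.1 fun h => (hside z hz h).not_gt hsz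
  have hzY : z.im < Y := lt_of_le_of_ne (hz.elim (·.2.2) (·.2.2)) fun h =>
    (htop z hz h).not_gt hlt
  rcases lt_or_ge τ z.im with hτz | hzτ
  · exact mem_of_superset (reProdIm_Icc_mem_nhds hre ⟨hτz, hzY⟩) subset_union_right
  · obtain ⟨h1, h2⟩ := not_or.1 fun h => (hnotch z hz hzτ h).not_gt hlt
    exact mem_of_superset (reProdIm_Icc_mem_nhds ⟨not_le.1 h1, not_le.1 h2⟩ ⟨him, hzY⟩)
      subset_union_left

theorem le_mul_cornerBarrier_of_notch (hτ : 0 < τ) (hτY : τ ≤ Y) (hε : 0 < ε)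
    (hc : ContinuousOn s ((Icc a b ×ℂ Icc 0 Y) \ {(a : ℂ), (b : ℂ)}))
    (hside : ∀ z ∈ Icc a b ×ℂ Icc 0 Y, z ∉ Ioo a b ×ℂ Ioi 0 → s z ≤ 0)
    (hharm : ∀ z ∈ Icc a b ×ℂ Icc 0 Y, 0 < s z → HarmonicAt s z)
    (hgrowth : ∀ z ∈ Icc a b ×ℂ Icc 0 Y, z.im ∈ Ioc 0 τ → s z ≤ ε / z.im ^ 2)
    {z : ℂ} (hz : z ∈ notchedRectangle a b Y τ) (hzτ : z.im ≤ τ)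
    (hnotch : z.re ≤ a + τ ∨ b - τ ≤ z.re) : s z ≤ 36864 * ε * cornerBarrier a b τ z := by
  have hrect := (notchedRectangle_subset hτ hz).1
  calc s z ≤ 1152 * ε / τ ^ 2 := by
        rcases hz with hz | hz
        · exact le_div_sq_of_rectangle hτ hτY hε hc hside hharm hgrowth ⟨hz.1, hrect.2.1, hzτ⟩
        · have him : z.im = τ := le_antisymm hzτ hz.2.1
          have := hgrowth z hrect ⟨him ▸ hτ, hzτ⟩
          rw [him] at this
          exact this.trans (by gcongr; linarith)
    _ = 36864 * ε * (1 / (32 * τ ^ 2)) := by field_simp; norm_num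
    _ ≤ 36864 * ε * cornerBarrier a b τ z := by
      gcongr; exact one_div_le_cornerBarrier hτ hrect.1 ⟨hrect.2.1, hzτ⟩ hnotch

theorem le_mul_div_add_of_rectangle (hτ : 0 < τ) (hτY : τ ≤ Y) (hε : 0 < ε) (hC : 0 ≤ C)
    (hc : ContinuousOn s ((Icc a b ×ℂ Icc 0 Y) \ {(a : ℂ), (b : ℂ)}))
    (hside : ∀ z ∈ Icc a b ×ℂ Icc 0 Y, z ∉ Ioo a b ×ℂ Ioi 0 → s z ≤ 0)
    (htop : ∀ z ∈ Icc a b ×ℂ Icc 0 Y, z.im = Y → s z ≤ C)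
    (hharm : ∀ z ∈ Icc a b ×ℂ Icc 0 Y, 0 < s z → HarmonicAt s z)
    (hgrowth : ∀ z ∈ Icc a b ×ℂ Icc 0 Y, z.im ∈ Ioc 0 τ → s z ≤ ε / z.im ^ 2)
    {z : ℂ} (hz : z ∈ Icc a b ×ℂ Icc τ Y) :
    s z ≤ C * (z.im / Y) + 73728 * ε / z.im ^ 2 := by
  have hY : 0 < Y := hτ.trans_le hτY
  set barrier : ℂ → ℝ := (C / Y) • Complex.im + (36864 * ε) • cornerBarrier a b τ with hbarrier
  have hbarrier_apply (z : ℂ) :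
      barrier z = C * (z.im / Y) + 36864 * ε * cornerBarrier a b τ z := by
    simp only [hbarrier, Pi.add_apply, Pi.smul_apply, smul_eq_mul]; ring
  have hrect {z : ℂ} (hz : z ∈ notchedRectangle a b Y τ) : z ∈ Icc a b ×ℂ Icc 0 Y :=
    (notchedRectangle_subset hτ hz).1
  have hcorner_nonneg {z : ℂ} (hz : z ∈ Icc a b ×ℂ Icc 0 Y) : 0 ≤ cornerBarrier a b τ z := by
    rw [cornerBarrier_eq_abs_add_abs hτ.le hz.1 hz.2.1]; positivity
  have hlinear_nonneg {z : ℂ} (hz : z ∈ Icc a b ×ℂ Icc 0 Y) : 0 ≤ C * (z.im / Y) :=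
    mul_nonneg hC (div_nonneg hz.2.1 hY.le)
  have hle := le_of_notchedRectangle (h := barrier) (hc.mono (notchedRectangle_subset hτ))
    (fun w hw => hharm w (hrect hw))
    (fun w hw => (analyticAt_id.harmonicAt_im.const_smul).add
      (harmonicAt_cornerBarrier (by linarith [(hrect hw).2.1])).const_smul)
    (fun w hw => by
      have := hcorner_nonneg (hrect hw); have := hlinear_nonneg (hrect hw)
      rw [hbarrier_apply]; positivity)
    (fun w hw => hside w (hrect hw))
    (fun w hw hwY => (htop w (hrect hw) hwY).trans <| by
      have := hcorner_nonneg (hrect hw)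
      rw [hbarrier_apply, hwY, div_self hY.ne', mul_one]
      exact le_add_of_nonneg_right (by positivity))
    (fun w hw hwτ hnotch => ?_) z (Or.inr hz)
  · calc s z ≤ C * (z.im / Y) + 36864 * ε * cornerBarrier a b τ z := hle.trans_eq (hbarrier_apply z)
      _ ≤ C * (z.im / Y) + 36864 * ε * (2 / z.im ^ 2) := by
        gcongr; exact cornerBarrier_le hτ.le hz.1 (hτ.trans_le hz.2.1)
      _ = _ := by ring
  · calc s w ≤ 36864 * ε * cornerBarrier a b τ w :=
          le_mul_cornerBarrier_of_notch hτ hτY hε hc hside hharm hgrowth hw hwτ hnotch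
      _ ≤ barrier w := by
        rw [hbarrier_apply]; exact le_add_of_nonneg_left (hlinear_nonneg (hrect hw))

end rectangle

variable {W : ℂ → ℝ} {c : ℝ}

theorem continuousAt_excess_halfStrip (hW : ∀ z : ℂ, 0 < z.im → ContinuousAt W z)
    (hside : ∀ z : ℂ, z.re = a ∨ z.re = b → z.im ∈ Ioc 0 Y → W z < c)
    (hbot : ∀ x ∈ Ioo a b, ∀ᶠ z : ℂ in 𝓝 (x : ℂ), 0 < z.im → W z ≤ c) {z : ℂ}
    (hz : z ∈ (Icc a b ×ℂ Icc 0 Y) \ {(a : ℂ), (b : ℂ)}) :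
    ContinuousAt (excess W (Ioo a b ×ℂ Ioi 0) c) z := by
  obtain ⟨⟨hre, him, himY⟩, hne⟩ := hz
  rw [mem_insert_iff, mem_singleton_iff, not_or] at hne
  rcases him.eq_or_lt with h0 | him
  · obtain ⟨x, rfl⟩ : ∃ x : ℝ, z = x := ⟨z.re, Complex.ext rfl h0.symm⟩
    have hx : x ∈ Ioo a b := ⟨hre.1.lt_of_ne fun h => hne.1 (by rw [← Complex.ofReal_re x, h]),
      hre.2.lt_of_ne fun h => hne.2 (by rw [← Complex.ofReal_re x, h])⟩
    refine continuousAt_excess_of_eventually_le ?_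
    filter_upwards [hbot x hx] with w hw hwS using hw hwS.2
  · by_cases hend : z.re = a ∨ z.re = b
    · refine continuousAt_excess_of_eventually_le ?_
      filter_upwards [(hW z him).eventually_lt_const (hside z hend ⟨him, himY⟩)] with w hw _
      exact hw.le
    · obtain ⟨ha, hb⟩ := not_or.1 hend
      exact continuousAt_excess_of_isOpen (isOpen_Ioo.reProdIm isOpen_Ioi)
        ⟨⟨hre.1.lt_of_ne' ha, hre.2.lt_of_ne hb⟩, him⟩ (hW z him)

theorem le_add_of_halfStrip {η : ℝ} (hC : 0 ≤ C) (hW : ∀ z : ℂ, 0 < z.im → HarmonicAt W z)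
    (hη : 0 ≤ η)
    (hgrowth : ∀ ε > 0, ∃ Y' > 0, ∀ z : ℂ, 0 < z.im → z.im < Y' → W z ≤ ε / z.im ^ 2)
    (hside : ∀ z : ℂ, z.re = a ∨ z.re = b → z.im ∈ Ioc 0 Y → W z ≤ η)
    (htop : ∀ z : ℂ, z.re ∈ Ioo a b → z.im = Y → W z ≤ η + C)
    (hbot : ∀ x ∈ Ioo a b, ∀ η' > η, ∀ᶠ z : ℂ in 𝓝 (x : ℂ), 0 < z.im → W z ≤ η')
    {z : ℂ} (hre : z.re ∈ Ioo a b) (him : z.im ∈ Ioc 0 Y) : W z ≤ η + C * (z.im / Y) := by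
  refine le_of_forall_pos_le_add fun δ hδ => ?_
  have him0 : 0 < z.im := him.1
  have hS : IsOpen (Ioo a b ×ℂ Ioi 0) := isOpen_Ioo.reProdIm isOpen_Ioi
  set s := excess W (Ioo a b ×ℂ Ioi 0) (η + δ / 2)
  obtain ⟨ε, hε, hεδ⟩ : ∃ ε > 0, 73728 * ε / z.im ^ 2 = δ / 2 :=
    ⟨δ * z.im ^ 2 / 147456, by positivity, by field_simp; norm_num⟩
  obtain ⟨Y', hY', hWY'⟩ := hgrowth ε hε
  set τ := min (Y' / 2) z.im
  have hτY' : τ < Y' := (min_le_left _ _).trans_lt (half_lt_self hY')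
  have hsz : s z ≤ C * (z.im / Y) + 73728 * ε / z.im ^ 2 := by
    refine le_mul_div_add_of_rectangle (lt_min (half_pos hY') him0) ((min_le_right _ _).trans him.2)
      hε hC (fun w hw => (continuousAt_excess_halfStrip (fun w hw => (hW w hw).1.continuousAt)
        (fun w hw hwY => (hside w hw hwY).trans_lt (by linarith))
        (fun x hx => hbot x hx _ (by linarith)) hw).continuousWithinAt)
      (fun w _ hwS => excess_le le_rfl fun h => absurd h hwS)
      (fun w _ hwY => excess_le hC fun h => (htop w h.1 hwY).trans (by linarith))
      (fun w _ hsw => harmonicAt_excess hS (hW w (mem_and_lt_of_excess_pos hsw).1.2) hsw)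
      (fun w _ hw => excess_le (by positivity) fun _ => ?_)
      ⟨Ioo_subset_Icc_self hre, min_le_right _ _, him.2⟩
    linarith [hWY' w hw.1 (hw.2.trans_lt hτY')]
  have hWs : W z - (η + δ / 2) ≤ s z := sub_le_excess ⟨hre, him.1⟩
  linarith

end halfStrip

/-! ### Vertical limits control unrestricted limits -/

theorem exists_Ioo_subset_compl_of_isClosed {X : Type*} [ConditionallyCompleteLinearOrder X]
    [TopologicalSpace X] [OrderTopology X] {Z : Set X} (hZ : IsClosed Z) {α β x : X} (hα : α ∈ Z)
    (hβ : β ∈ Z) (hx : x ∈ Icc α β) (hxZ : x ∉ Z) :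
    ∃ a ∈ Z ∩ Ici α, ∃ b ∈ Z ∩ Iic β, x ∈ Ioo a b ∧ Ioo a b ⊆ Zᶜ := by
  obtain ⟨a, ⟨haZ, ha⟩, hamax⟩ := (isCompact_Icc.inter_left hZ).exists_isGreatest
    (⟨α, hα, le_rfl, hx.1⟩ : (Z ∩ Icc α x).Nonempty)
  obtain ⟨b, ⟨hbZ, hb⟩, hbmin⟩ := (isCompact_Icc.inter_left hZ).exists_isLeast
    (⟨β, hβ, hx.2, le_rfl⟩ : (Z ∩ Icc x β).Nonempty)
  refine ⟨a, ⟨haZ, ha.1⟩, b, ⟨hbZ, hb.2⟩, ⟨ha.2.lt_of_ne fun e => hxZ (e ▸ haZ),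
    hb.1.lt_of_ne fun e => hxZ (e ▸ hbZ)⟩, fun t ht htZ => ?_⟩
  rcases le_total t x with htx | hxt
  · exact ht.1.not_ge (hamax ⟨htZ, ha.1.trans ht.1.le, htx⟩)
  · exact ht.2.not_ge (hbmin ⟨htZ, hxt, ht.2.le.trans hb.2⟩)

theorem exists_mem_nhdsWithin_of_subset_iUnion {X ι : Type*} [TopologicalSpace X] [Countable ι]
    {Z : Set X} [BaireSpace Z] (hZ : Z.Nonempty) {A : ι → Set X} (hA : ∀ i, IsClosed (A i))
    (hZA : Z ⊆ ⋃ i, A i) : ∃ i, ∃ x ∈ Z, A i ∈ 𝓝[Z] x := by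
  have := hZ.to_subtype
  obtain ⟨i, ⟨x, hxZ⟩, hx⟩ := nonempty_interior_of_iUnion_of_closed
    (fun i => (hA i).preimage (continuous_subtype_val (p := (· ∈ Z))))
    (eq_univ_of_forall fun x => by simpa using hZA x.2)
  refine ⟨i, x, hxZ, ?_⟩
  exact preimage_coe_mem_nhds_subtype.1 (mem_interior_iff_mem_nhds.1 hx)

section halfPlane

variable {W : ℂ → ℝ} {η : ℝ}

/-- The points of the real line at which the unrestricted upper limit of `W`, taken from the upper
half plane, is at most `η`. -/
def limsupLESet (W : ℂ → ℝ) (η : ℝ) : Set ℝ :=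
  {x | ∀ η' > η, ∀ᶠ z : ℂ in 𝓝 (x : ℂ), 0 < z.im → W z ≤ η'}

theorem Ioo_subset_limsupLESet {α β C Y : ℝ} (hY : 0 < Y)
    (hle : ∀ z : ℂ, z.re ∈ Ioo α β → z.im ∈ Ioc 0 Y → W z ≤ η + C * (z.im / Y)) :
    Ioo α β ⊆ limsupLESet W η := by
  intro x hx η' hη'
  have hbound : ∀ᶠ z : ℂ in 𝓝 (x : ℂ), η + C * (z.im / Y) < η' :=
    (show ContinuousAt (fun z : ℂ => η + C * (z.im / Y)) x by fun_prop).eventually_lt_const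
      (by simpa using hη')
  have hre : ∀ᶠ z : ℂ in 𝓝 (x : ℂ), z.re ∈ Ioo α β :=
    Complex.continuous_re.continuousAt (Ioo_mem_nhds hx.1 hx.2)
  have him : ∀ᶠ z : ℂ in 𝓝 (x : ℂ), z.im < Y :=
    Complex.continuous_im.continuousAt.eventually_lt_const (by simpa using hY)
  filter_upwards [hbound, hre, him] with z hz hzre hzim hz0
  exact (hle z hzre ⟨hz0, hzim.le⟩).trans hz.le

theorem isClosed_setOf_forall_mk_le (hW : ∀ z : ℂ, 0 < z.im → ContinuousAt W z) (δ : ℝ) :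
    IsClosed {x : ℝ | ∀ y ∈ Ioc 0 δ, W ⟨x, y⟩ ≤ η} := by
  simp only [ofPred_forall]
  refine isClosed_biInter fun y hy => isClosed_le ?_ continuous_const
  exact continuous_iff_continuousAt.2 fun x => (hW ⟨x, y⟩ hy.1).comp_of_eq
    (f := fun x : ℝ => (⟨x, y⟩ : ℂ)) (by simp only [Complex.mk_eq_add_mul_I]; fun_prop) rfl

theorem exists_forall_mem_Icc_le_of_im_eq (hW : ∀ z : ℂ, 0 < z.im → ContinuousAt W z) {Y : ℝ}
    (hY : 0 < Y) (α β : ℝ) :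
    ∃ C, 0 ≤ C ∧ ∀ z : ℂ, z.re ∈ Icc α β → z.im = Y → W z ≤ η + C := by
  obtain ⟨M, hM⟩ := ((isCompact_Icc (a := α) (b := β)).reProdIm
    (isCompact_singleton (x := Y))).bddAbove_image (f := W) fun z hz =>
      (hW z (hY.trans_eq hz.2.symm)).continuousWithinAt
  refine ⟨|M - η|, abs_nonneg _, fun z hre him => ?_⟩
  linarith [hM (mem_image_of_mem W ⟨hre, him⟩), le_abs_self (M - η)]

theorem le_add_of_isClosed {Z : Set ℝ} (hZ : IsClosed Z) {α β C Y : ℝ} (hα : α ∈ Z) (hβ : β ∈ Z)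
    (hC : 0 ≤ C) (hη : 0 ≤ η) (hW : ∀ z : ℂ, 0 < z.im → HarmonicAt W z)
    (hgrowth : ∀ ε > 0, ∃ Y' > 0, ∀ z : ℂ, 0 < z.im → z.im < Y' → W z ≤ ε / z.im ^ 2)
    (hside : ∀ x ∈ Z, ∀ y ∈ Ioc 0 Y, W ⟨x, y⟩ ≤ η)
    (htop : ∀ z : ℂ, z.re ∈ Icc α β → z.im = Y → W z ≤ η + C)
    (hbot : Icc α β \ Z ⊆ limsupLESet W η)
    {z : ℂ} (hre : z.re ∈ Icc α β) (him : z.im ∈ Ioc 0 Y) : W z ≤ η + C * (z.im / Y) := by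
  by_cases hz : z.re ∈ Z
  · exact (hside z.re hz z.im him).trans
      (le_add_of_nonneg_right (mul_nonneg hC (div_nonneg him.1.le (him.1.le.trans him.2))))
  obtain ⟨a, ⟨ha, hαa⟩, b, ⟨hb, hbβ⟩, hab, hgap⟩ :=
    exists_Ioo_subset_compl_of_isClosed hZ hα hβ hre hz
  have hsub : Ioo a b ⊆ Icc α β := fun x hx => ⟨hαa.trans hx.1.le, hx.2.le.trans hbβ⟩
  refine le_add_of_halfStrip hC hW hη hgrowth (fun w hw hwim => ?_)
    (fun w hw => htop w (hsub hw)) (fun x hx => hbot ⟨hsub hx, hgap hx⟩) hab him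
  exact hside w.re (hw.elim (· ▸ ha) (· ▸ hb)) w.im hwim

theorem exists_Ioo_subset_limsupLESet (hη : 0 ≤ η)
    (hW : ∀ z : ℂ, 0 < z.im → HarmonicAt W z)
    (hgrowth : ∀ ε > 0, ∃ Y' > 0, ∀ z : ℂ, 0 < z.im → z.im < Y' → W z ≤ ε / z.im ^ 2)
    (hvert : ∀ x : ℝ, ∃ δ > 0, ∀ y ∈ Ioc 0 δ, W ⟨x, y⟩ ≤ η)
    {Z : Set ℝ} (hZ : IsClosed Z) (hne : Z.Nonempty) (hZη : Zᶜ ⊆ limsupLESet W η) :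
    ∃ x ∈ Z, ∃ α β, x ∈ Ioo α β ∧ Ioo α β ⊆ limsupLESet W η := by
  have hWc : ∀ z : ℂ, 0 < z.im → ContinuousAt W z := fun z hz => (hW z hz).1.continuousAt
  have := hZ.completeSpace_coe
  obtain ⟨n, x, hxZ, hx⟩ := exists_mem_nhdsWithin_of_subset_iUnion hne
    (fun n : ℕ => isClosed_setOf_forall_mk_le (η := η) hWc (1 / (n + 1))) fun x _ => by
      obtain ⟨δ, hδ, h⟩ := hvert x
      obtain ⟨n, hn⟩ := exists_nat_one_div_lt hδ
      exact mem_iUnion.2 ⟨n, fun y hy => h y ⟨hy.1, hy.2.trans hn.le⟩⟩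
  obtain ⟨ρ, hρ, hball⟩ := Metric.mem_nhdsWithin_iff.1 hx
  set α := x - ρ / 2 with hα
  set β := x + ρ / 2 with hβ
  obtain ⟨δ₁, hδ₁, h₁⟩ := hvert α
  obtain ⟨δ₂, hδ₂, h₂⟩ := hvert β
  obtain ⟨Y, hY, hYn, hY₁, hY₂⟩ : ∃ Y > 0, Y ≤ 1 / ((n : ℝ) + 1) ∧ Y ≤ δ₁ ∧ Y ≤ δ₂ :=
    ⟨min (1 / ((n : ℝ) + 1)) (min δ₁ δ₂), lt_min (by positivity) (lt_min hδ₁ hδ₂),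
      min_le_left _ _, (min_le_right _ _).trans (min_le_left _ _),
      (min_le_right _ _).trans (min_le_right _ _)⟩
  obtain ⟨C, hC, htop⟩ := exists_forall_mem_Icc_le_of_im_eq (η := η) hWc hY α β
  refine ⟨x, hxZ, α, β, ⟨by linarith [hα], by linarith [hβ]⟩, Ioo_subset_limsupLESet (C := C) hY
    fun z hre him => ?_⟩
  have hclosed : IsClosed ((Z ∩ Icc α β) ∪ {α, β}) :=
    (hZ.inter isClosed_Icc).union (toFinite {α, β}).isClosed
  refine le_add_of_isClosed hclosed (.inr (.inl rfl)) (.inr (.inr rfl)) hC hη hW hgrowth ?_ htop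
    (fun t ht => hZη fun htZ => ht.2 (.inl ⟨htZ, ht.1⟩)) (Ioo_subset_Icc_self hre) him
  rintro t (⟨htZ, ht⟩ | rfl | rfl) y hy
  · have htball : t ∈ Metric.ball x ρ := by
      rw [Metric.mem_ball, Real.dist_eq, abs_lt]
      constructor <;> linarith [ht.1, ht.2]
    exact hball ⟨htball, htZ⟩ y ⟨hy.1, hy.2.trans hYn⟩
  · exact h₁ y ⟨hy.1, hy.2.trans hY₁⟩
  · exact h₂ y ⟨hy.1, hy.2.trans hY₂⟩

theorem eventually_le_of_forall_vertical_le (hW : ∀ z : ℂ, 0 < z.im → HarmonicAt W z)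
    (hgrowth : ∀ ε > 0, ∃ Y' > 0, ∀ z : ℂ, 0 < z.im → z.im < Y' → W z ≤ ε / z.im ^ 2)
    (hvert : ∀ x : ℝ, ∀ η > 0, ∀ᶠ y in 𝓝[>] (0 : ℝ), W ⟨x, y⟩ ≤ η) (hη : 0 < η) (x : ℝ) :
    ∀ᶠ z : ℂ in 𝓝 (x : ℂ), 0 < z.im → W z ≤ η := by
  have hvert' (x : ℝ) : ∃ δ > 0, ∀ y ∈ Ioc 0 δ, W ⟨x, y⟩ ≤ η / 2 :=
    mem_nhdsGT_iff_exists_Ioc_subset.1 (hvert x (η / 2) (half_pos hη))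
  suffices h : x ∈ interior (limsupLESet W (η / 2)) from interior_subset h η (half_lt_self hη)
  by_contra hx
  obtain ⟨t, ht, α, β, htαβ, hsub⟩ := exists_Ioo_subset_limsupLESet (half_pos hη).le hW hgrowth
    hvert' isOpen_interior.isClosed_compl ⟨x, hx⟩ (by rw [compl_compl]; exact interior_subset)
  exact ht (interior_maximal hsub isOpen_Ioo htαβ)

end halfPlane

/-! ### A maximum principle on the disc with radial boundary limits -/

theorem norm_exp_I_mul (ζ : ℂ) : ‖Complex.exp (Complex.I * ζ)‖ = Real.exp (-ζ.im) := by
  rw [Complex.norm_exp, Complex.I_mul_re]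

theorem norm_exp_I_mul_lt_one {ζ : ℂ} (hζ : 0 < ζ.im) : ‖Complex.exp (Complex.I * ζ)‖ < 1 := by
  rwa [norm_exp_I_mul, Real.exp_lt_one_iff, neg_lt_zero]

theorem exp_I_mul_arg_sub_log_norm {z : ℂ} (hz : z ≠ 0) :
    Complex.exp (Complex.I * ⟨z.arg, -Real.log ‖z‖⟩) = z := by
  rw [show Complex.I * (⟨z.arg, -Real.log ‖z‖⟩ : ℂ) = Complex.log z from
    Complex.ext (by simp [Complex.log_re]) (by simp [Complex.log_im]), Complex.exp_log hz]

theorem exp_I_mul_mk (x y : ℝ) :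
    Complex.exp (Complex.I * ⟨x, y⟩) =
    Real.exp (-y) *
      Complex.exp (((toIcoMod Real.two_pi_pos (-Real.pi) x : ℝ) : ℂ) * Complex.I) := by
  have hx : ((toIcoMod Real.two_pi_pos (-Real.pi) x : ℝ) : ℂ) =
      x - toIcoDiv Real.two_pi_pos (-Real.pi) x * (2 * Real.pi) := by
    rw [← self_sub_toIcoDiv_zsmul, zsmul_eq_mul]; push_cast; rfl
  rw [Complex.ofReal_exp, ← Complex.exp_add, Complex.exp_eq_exp_iff_exists_int]
  refine ⟨toIcoDiv Real.two_pi_pos (-Real.pi) x, ?_⟩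
  rw [hx, Complex.mk_eq_add_mul_I]
  push_cast
  linear_combination (y : ℂ) * Complex.I_sq

theorem half_le_one_sub_exp_neg {y : ℝ} (h0 : 0 ≤ y) (h1 : y ≤ 1) :
    y / 2 ≤ 1 - Real.exp (-y) := by
  have h : (1 + y) * Real.exp (-y) ≤ 1 := by
    rw [Real.exp_neg, ← div_eq_mul_inv, div_le_one (Real.exp_pos y), add_comm]
    exact Real.add_one_le_exp y
  nlinarith [Real.exp_pos (-y)]

section disc

variable {w : ℂ → ℝ}

theorem exists_comp_exp_I_mul_le_div_im_sq
    (hgrowth : ∀ ε > 0, ∃ ρ < 1, ∀ z : ℂ, ρ < ‖z‖ → ‖z‖ < 1 → w z ≤ ε / (1 - ‖z‖) ^ 2)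
    {ε : ℝ} (hε : 0 < ε) :
    ∃ Y > 0, ∀ z : ℂ, 0 < z.im → z.im < Y → w (Complex.exp (Complex.I * z)) ≤ ε / z.im ^ 2 := by
  obtain ⟨ρ, hρ, hle⟩ := hgrowth (ε / 4) (by positivity)
  have hnear : ∀ᶠ y : ℝ in 𝓝[>] 0, ρ < Real.exp (-y) :=
    (show ContinuousWithinAt (fun y : ℝ => Real.exp (-y)) (Ioi 0) 0 by
      fun_prop).eventually_const_lt (by simpa using hρ)
  obtain ⟨δ, hδ, hδρ⟩ := mem_nhdsGT_iff_exists_Ioo_subset.1 hnear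
  refine ⟨min δ 1, lt_min hδ one_pos, fun z hz hzδ => ?_⟩
  have hexp := hle (Complex.exp (Complex.I * z))
    (by rw [norm_exp_I_mul]; exact hδρ ⟨hz, hzδ.trans_le (min_le_left _ _)⟩)
    (norm_exp_I_mul_lt_one hz)
  have hhalf := half_le_one_sub_exp_neg hz.le (hzδ.le.trans (min_le_right _ _))
  calc w (Complex.exp (Complex.I * z))
      ≤ ε / 4 / (1 - Real.exp (-z.im)) ^ 2 := by rwa [norm_exp_I_mul] at hexp
    _ ≤ ε / 4 / (z.im / 2) ^ 2 := by gcongr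
    _ = ε / z.im ^ 2 := by field_simp; norm_num

theorem eventually_comp_exp_I_mul_le {η : ℝ} (hrad : ∀ θ ∈ Ico (-Real.pi) Real.pi,
      ∀ᶠ r : ℝ in 𝓝[<] 1, w ((r : ℂ) * Complex.exp ((θ : ℂ) * Complex.I)) ≤ η) (x : ℝ) :
    ∀ᶠ y in 𝓝[>] (0 : ℝ), w (Complex.exp (Complex.I * ⟨x, y⟩)) ≤ η := by
  have hθ : toIcoMod Real.two_pi_pos (-Real.pi) x ∈ Ico (-Real.pi) Real.pi := by
    have := toIcoMod_mem_Ico Real.two_pi_pos (-Real.pi) x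
    rwa [show -Real.pi + 2 * Real.pi = Real.pi by ring] at this
  have hexp : Tendsto (fun y : ℝ => Real.exp (-y)) (𝓝[>] 0) (𝓝[<] 1) := by
    refine tendsto_nhdsWithin_iff.2 ⟨tendsto_nhdsWithin_of_tendsto_nhds ?_, ?_⟩
    · exact Continuous.tendsto' (by fun_prop) _ _ (by simp)
    · filter_upwards [self_mem_nhdsWithin] with y hy
      exact Real.exp_lt_one_iff.2 (neg_lt_zero.2 hy)
  filter_upwards [hexp.eventually (hrad _ hθ)] with y hy
  rwa [exp_I_mul_mk]

theorem exists_forall_norm_gt_le {η : ℝ}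
    (hnear : ∀ x : ℝ, ∀ᶠ z : ℂ in 𝓝 (x : ℂ), 0 < z.im → w (Complex.exp (Complex.I * z)) ≤ η) :
    ∃ ρ < 1, ∀ z : ℂ, ρ < ‖z‖ → ‖z‖ < 1 → w z ≤ η := by
  have hunif : ∀ᶠ y : ℝ in 𝓝 0, ∀ x ∈ Icc (-Real.pi) Real.pi,
      0 < y → w (Complex.exp (Complex.I * ⟨x, y⟩)) ≤ η := by
    refine isCompact_Icc.eventually_forall_of_forall_eventually fun x _ => ?_
    have hmk : Tendsto (fun p : ℝ × ℝ => (⟨p.2, p.1⟩ : ℂ)) (𝓝 (0, x)) (𝓝 (x : ℂ)) := by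
      simp only [Complex.mk_eq_add_mul_I]
      exact Continuous.tendsto' (by fun_prop) _ _ (by simp)
    exact hmk.eventually (hnear x)
  have hlog : Tendsto (fun r : ℝ => -Real.log r) (𝓝[<] 1) (𝓝 0) :=
    tendsto_nhdsWithin_of_tendsto_nhds <|
      by simpa using! (Real.continuousAt_log one_ne_zero).neg.tendsto
  obtain ⟨ρ, hρ, hρη⟩ := (mem_nhdsLT_iff_exists_mem_Ico_Ioo_subset zero_lt_one).1
    (hlog.eventually hunif)
  refine ⟨ρ, hρ.2, fun z hz hz1 => ?_⟩
  have hz0 : 0 < ‖z‖ := hρ.1.trans_lt hz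
  have := hρη ⟨hz, hz1⟩ z.arg ⟨(Complex.neg_pi_lt_arg z).le, Complex.arg_le_pi z⟩
    (neg_pos.2 (Real.log_neg hz0 hz1))
  rwa [exp_I_mul_arg_sub_log_norm (norm_pos_iff.1 hz0)] at this

theorem nonpos_of_forall_radial_limsup_nonpos (hw : ∀ z : ℂ, ‖z‖ < 1 → HarmonicAt w z)
    (hgrowth : ∀ ε > 0, ∃ ρ < 1, ∀ z : ℂ, ρ < ‖z‖ → ‖z‖ < 1 → w z ≤ ε / (1 - ‖z‖) ^ 2)
    (hrad : ∀ θ ∈ Ico (-Real.pi) Real.pi, ∀ η > 0, ∀ᶠ r : ℝ in 𝓝[<] 1,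
      w ((r : ℂ) * Complex.exp ((θ : ℂ) * Complex.I)) ≤ η) {z : ℂ} (hz : ‖z‖ < 1) : w z ≤ 0 := by
  refine le_of_forall_pos_le_add fun η hη => ?_
  have hharm : ∀ ζ : ℂ, 0 < ζ.im →
      HarmonicAt (w ∘ fun ζ => Complex.exp (Complex.I * ζ)) ζ := fun ζ hζ =>
    harmonicAt_comp_of_analyticAt (hw _ (norm_exp_I_mul_lt_one hζ))
      (Differentiable.analyticAt (by fun_prop) ζ)
  obtain ⟨ρ₀, hρ₀, hle⟩ := exists_forall_norm_gt_le (w := w) <|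
    eventually_le_of_forall_vertical_le hharm
      (fun ε hε => exists_comp_exp_I_mul_le_div_im_sq hgrowth hε)
      (fun x η hη => eventually_comp_exp_I_mul_le (fun θ hθ => hrad θ hθ η hη) x) hη
  obtain ⟨ρ, hρ, hρ1⟩ := exists_between (max_lt hρ₀ hz)
  have hball : ∀ p ∈ Metric.closedBall (0 : ℂ) ρ, ‖p‖ < 1 := fun p hp =>
    (mem_closedBall_zero_iff.1 hp).trans_lt hρ1
  refine (le_of_harmonicAt_of_lt (isCompact_closedBall (0 : ℂ) ρ) (s := w) (h := fun _ => 0 + η)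
    (fun p hp => (hw p (hball p hp)).1.continuousAt.continuousWithinAt) continuousOn_const
    (fun p hp hlt => ⟨?_, hw p (hball p hp), ?_⟩) z
    (mem_closedBall_zero_iff.2 ((le_max_right _ _).trans hρ.le)))
  · have hpρ : ‖p‖ ≤ ρ₀ := not_lt.1 fun h =>
      (hle p h (hball p hp)).not_gt (by rwa [zero_add] at hlt)
    exact mem_of_superset (Metric.isOpen_ball.mem_nhds
      (mem_ball_zero_iff.2 (hpρ.trans_lt ((le_max_left _ _).trans_lt hρ))))
      Metric.ball_subset_closedBall
  · exact ⟨contDiffAt_const, by simp [Filter.EventuallyEq]⟩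

end disc

/-! ### Straddling intervals -/

/-- The filter of the pairs `(l, u)` that bound a small interval around `θ`, that is
`l ≤ θ ≤ u` with `l` and `u` close to `θ`. Quantifying over it replaces the fine tagged partitions
of Henstock–Kurzweil integration by a local condition at each tag. -/
def straddle (θ : ℝ) : Filter (ℝ × ℝ) := 𝓝[≤] θ ×ˢ 𝓝[≥] θ

section straddle

variable {θ : ℝ}

theorem eventually_straddle_iff {P : ℝ × ℝ → Prop} :
    (∀ᶠ p in straddle θ, P p) ↔
      ∃ a < θ, ∃ b > θ, ∀ l ∈ Icc a θ, ∀ u ∈ Icc θ b, P (l, u) := by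
  refine ((nhdsLE_basis_Icc.prod nhdsGE_basis_Icc).eventually_iff).trans ⟨?_, ?_⟩
  · rintro ⟨⟨a, b⟩, ⟨ha, hb⟩, h⟩
    exact ⟨a, ha, b, hb, fun l hl u hu => h ⟨hl, hu⟩⟩
  · rintro ⟨a, ha, b, hb, h⟩
    exact ⟨(a, b), ⟨ha, hb⟩, fun p hp => h p.1 hp.1 p.2 hp.2⟩

theorem eventually_straddle_fst_le_and_le_snd (θ : ℝ) :
    ∀ᶠ p in straddle θ, p.1 ≤ θ ∧ θ ≤ p.2 :=
  Eventually.prod_mk (pa := (· ≤ θ)) self_mem_nhdsWithin (pb := (θ ≤ ·)) self_mem_nhdsWithin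

theorem tendsto_fst_straddle (θ : ℝ) : Tendsto Prod.fst (straddle θ) (𝓝 θ) :=
  tendsto_fst.mono_right nhdsWithin_le_nhds

theorem tendsto_snd_straddle (θ : ℝ) : Tendsto Prod.snd (straddle θ) (𝓝 θ) :=
  tendsto_snd.mono_right nhdsWithin_le_nhds

theorem tendsto_add_const_straddle (θ c : ℝ) :
    Tendsto (fun p : ℝ × ℝ => (p.1 + c, p.2 + c)) (straddle θ) (straddle (θ + c)) := by
  have hcont : Continuous fun x : ℝ => x + c := by fun_prop
  exact Tendsto.prodMap
    (hcont.continuousWithinAt.tendsto_nhdsWithin fun _ hx => add_le_add_left hx c)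
    (hcont.continuousWithinAt.tendsto_nhdsWithin fun _ hx => add_le_add_left hx c)

theorem eventually_straddle_abs_sub_le_of_hasDerivAt_zero {D : ℝ → ℝ}
    (hD : HasDerivAt D 0 θ) {ε : ℝ} (hε : 0 < ε) :
    ∀ᶠ p in straddle θ, |D p.2 - D p.1| ≤ ε * (p.2 - p.1) := by
  have hnear : ∀ᶠ x in 𝓝 θ, |D x - D θ| ≤ ε * |x - θ| := by
    simpa using (hasDerivAt_iff_isLittleO.1 hD).def hε
  filter_upwards [(tendsto_fst_straddle θ).eventually hnear,
    (tendsto_snd_straddle θ).eventually hnear, eventually_straddle_fst_le_and_le_snd θ]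
    with p hl hu hp
  rw [abs_of_nonpos (sub_nonpos.2 hp.1)] at hl
  rw [abs_of_nonneg (sub_nonneg.2 hp.2)] at hu
  rw [abs_le] at hl hu ⊢
  constructor <;> linarith [hl.1, hl.2, hu.1, hu.2]

theorem continuousAt_of_forall_eventually_straddle {F : ℝ → ℝ}
    (h : ∀ ε > 0, ∀ᶠ p in straddle θ, |F p.2 - F p.1| < ε) : ContinuousAt F θ := by
  have hleft : Tendsto (fun x => (x, θ)) (𝓝[≤] θ) (straddle θ) :=
    tendsto_id.prodMk (tendsto_const_pure.mono_right (pure_le_nhdsWithin self_mem_Ici))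
  have hright : Tendsto (fun x => (θ, x)) (𝓝[≥] θ) (straddle θ) :=
    (tendsto_const_pure.mono_right (pure_le_nhdsWithin self_mem_Iic)).prodMk tendsto_id
  refine Metric.tendsto_nhds.2 fun ε hε => ?_
  rw [← nhdsLE_sup_nhdsGE, eventually_sup]
  refine ⟨?_, hright.eventually (h ε hε)⟩
  filter_upwards [hleft.eventually (h ε hε)] with x hx
  rwa [Real.dist_eq, abs_sub_comm]

theorem le_of_forall_eventually_straddle_le {ψ : ℝ → ℝ} {a b : ℝ} (hab : a ≤ b)
    (h : ∀ θ ∈ Icc a b, ∀ᶠ p in straddle θ, ψ p.1 ≤ ψ p.2) : ψ a ≤ ψ b := by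
  set A : Set ℝ := {x ∈ Icc a b | ψ a ≤ ψ x}
  have ha : a ∈ A := ⟨left_mem_Icc.2 hab, le_rfl⟩
  have hA : IsLUB A (sSup A) := isLUB_csSup ⟨a, ha⟩ ⟨b, fun x hx => hx.1.2⟩
  have hsb : sSup A ≤ b := hA.2 fun x hx => hx.1.2
  obtain ⟨l, hl, u, hu, hlu⟩ := eventually_straddle_iff.1 (h (sSup A) ⟨hA.1 ha, hsb⟩)
  obtain ⟨x, hx, hlx, hxs⟩ := hA.exists_between hl
  have hright : ∀ y ∈ Icc (sSup A) u, ψ a ≤ ψ y := fun y hy =>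
    hx.2.trans (hlu x ⟨hlx.le, hxs⟩ y hy)
  rcases hsb.eq_or_lt with hs | hs
  · exact hs ▸ hright (sSup A) (left_mem_Icc.2 hu.le)
  · have hlt : sSup A < min u b := lt_min hu hs
    have hmem : min u b ∈ A := ⟨⟨(hA.1 ha).trans hlt.le, min_le_right u b⟩,
      hright _ ⟨hlt.le, min_le_left u b⟩⟩
    exact absurd (hA.1 hmem) hlt.not_ge

end straddle

/-! ### Stieltjes integrals of continuously differentiable functions -/

/-- The Stieltjes integral `∫ g dN` over the interval from `α` to `β`, integrated by parts so that
it makes sense for every locally integrable `N` once `g` is continuously differentiable. -/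
def stieltjesIntegral (N g : ℝ → ℝ) (α β : ℝ) : ℝ :=
  N β * g β - N α * g α - ∫ φ in α..β, N φ * deriv g φ

section stieltjes

open MeasureTheory (volume)
open intervalIntegral

variable {N M g : ℝ → ℝ} {α β γ : ℝ}

theorem intervalIntegrable_mul_deriv (hN : IntervalIntegrable N volume α β)
    (hg : ContDiff ℝ 1 g) : IntervalIntegrable (fun φ => N φ * deriv g φ) volume α β :=
  hN.mul_continuousOn hg.continuous_deriv_one.continuousOn

theorem stieltjesIntegral_add_adjacent (hαβ : IntervalIntegrable N volume α β)
    (hβγ : IntervalIntegrable N volume β γ) (hg : ContDiff ℝ 1 g) :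
    stieltjesIntegral N g α β + stieltjesIntegral N g β γ = stieltjesIntegral N g α γ := by
  unfold stieltjesIntegral
  rw [← integral_add_adjacent_intervals (intervalIntegrable_mul_deriv hαβ hg)
    (intervalIntegrable_mul_deriv hβγ hg)]
  ring

theorem stieltjesIntegral_add (hN : IntervalIntegrable N volume α β)
    (hM : IntervalIntegrable M volume α β) (hg : ContDiff ℝ 1 g) :
    stieltjesIntegral (fun x => N x + M x) g α β =
      stieltjesIntegral N g α β + stieltjesIntegral M g α β := by
  simp only [stieltjesIntegral, add_mul, integral_add (intervalIntegrable_mul_deriv hN hg)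
    (intervalIntegrable_mul_deriv hM hg)]
  ring

theorem stieltjesIntegral_neg (N g : ℝ → ℝ) (α β : ℝ) :
    stieltjesIntegral (fun x => -N x) g α β = -stieltjesIntegral N g α β := by
  simp only [stieltjesIntegral, neg_mul, integral_neg]
  ring

theorem stieltjesIntegral_eq_integral {N' : ℝ → ℝ} (hN : ∀ x, HasDerivAt N (N' x) x)
    (hN' : Continuous N') (hg : ContDiff ℝ 1 g) :
    stieltjesIntegral N g α β = ∫ φ in α..β, N' φ * g φ := by
  rw [stieltjesIntegral, integral_mul_deriv_eq_deriv_mul (fun x _ => hN x)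
    (fun x _ => (hg.differentiable_one x).hasDerivAt) (hN'.intervalIntegrable _ _)
    (hg.continuous_deriv_one.intervalIntegrable _ _), sub_sub_cancel]

theorem stieltjesIntegral_comp_add_right (N g : ℝ → ℝ) (α β c : ℝ) :
    stieltjesIntegral (fun x => N (x + c)) (fun x => g (x + c)) α β =
      stieltjesIntegral N g (α + c) (β + c) := by
  simp only [stieltjesIntegral, deriv_comp_add_const,
    integral_comp_add_right fun x => N x * deriv g x]

theorem stieltjesIntegral_add_const (hN : IntervalIntegrable N volume α β)
    (hg : ContDiff ℝ 1 g) (c : ℝ) :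
    stieltjesIntegral (fun x => N x + c) g α β = stieltjesIntegral N g α β := by
  rw [stieltjesIntegral_add hN intervalIntegrable_const hg,
    stieltjesIntegral_eq_integral (fun x => hasDerivAt_const x c) continuous_const hg]
  simp

theorem stieltjesIntegral_period_eq {T c : ℝ} (hN : ∀ a b, IntervalIntegrable N volume a b)
    (hNT : ∀ x, N (x + T) = N x + c) (hg : ContDiff ℝ 1 g) (hgT : Function.Periodic g T)
    (α β : ℝ) : stieltjesIntegral N g α (α + T) = stieltjesIntegral N g β (β + T) := by
  have hshift : stieltjesIntegral N g (α + T) (β + T) = stieltjesIntegral N g α β := by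
    rw [← stieltjesIntegral_comp_add_right, ← stieltjesIntegral_add_const (hN α β) hg c]
    simp only [hNT, hgT _]
  linarith [stieltjesIntegral_add_adjacent (hN α β) (hN β (β + T)) hg,
    stieltjesIntegral_add_adjacent (hN α (α + T)) (hN (α + T) (β + T)) hg]

theorem stieltjesIntegral_symm_of_even (hN : ∀ a b, IntervalIntegrable N volume a b)
    (hg : ContDiff ℝ 1 g) (heven : Function.Even g) (θ δ : ℝ) :
    stieltjesIntegral N (fun φ => g (φ - θ)) (θ - δ) (θ + δ) =
      stieltjesIntegral (fun t => N (θ + t) - N (θ - t)) g 0 δ := by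
  have hright : IntervalIntegrable (fun t => N (θ + t)) volume 0 δ := by
    simpa using (hN (θ + 0) (θ + δ)).comp_add_left θ
  have hleft : IntervalIntegrable (fun t => N (θ - t)) volume 0 δ := by
    simpa using (hN (θ - 0) (θ - δ)).comp_sub_left θ
  have hodd : ∀ t, deriv g (-t) = -deriv g t := fun t => by
    simpa [heven _] using (congrArg Neg.neg (deriv_comp_neg g t)).symm
  have hfold : stieltjesIntegral N (fun φ => g (φ - θ)) (θ - δ) θ =
      stieltjesIntegral (fun t => -N (θ - t)) g 0 δ := by
    have hsub := integral_comp_sub_left (a := 0) (b := δ)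
      (fun φ => N φ * deriv g (φ - θ)) θ
    simp only [sub_sub_cancel_left, hodd, sub_zero] at hsub
    simp only [stieltjesIntegral, deriv_comp_sub_const, ← hsub, sub_sub_cancel_left, heven _,
      sub_self, sub_zero, mul_neg, neg_mul]
    ring
  have hshift := stieltjesIntegral_comp_add_right N (fun φ => g (φ - θ)) 0 δ θ
  simp only [add_sub_cancel_right, zero_add] at hshift
  simp only [add_comm _ θ] at hshift
  have hgθ : ContDiff ℝ 1 fun φ => g (φ - θ) := hg.comp (contDiff_id.sub contDiff_const)
  rw [← stieltjesIntegral_add_adjacent (hN _ θ) (hN θ _) hgθ, hfold, ← hshift,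
    ← stieltjesIntegral_add (N := fun t => -N (θ - t)) hleft.neg hright hg]
  simp only [neg_add_eq_sub]

theorem neg_mul_sub_mul_sub_le_stieltjesIntegral (hN : Monotone N) (hg : ContDiff ℝ 1 g)
    (hg0 : 0 ≤ g α) (hαβ : α ≤ β) {L : ℝ} (hL : ∀ x ∈ Icc α β, |deriv g x| ≤ L) :
    -(L * (N β - N α) * (β - α)) ≤ stieltjesIntegral N g α β := by
  have hsplit : stieltjesIntegral N g α β =
      (N β - N α) * g α + ∫ φ in α..β, (N β - N φ) * deriv g φ := by
    simp only [sub_mul, integral_sub (intervalIntegrable_mul_deriv intervalIntegrable_const hg)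
      (intervalIntegrable_mul_deriv hN.intervalIntegrable hg), integral_const_mul,
      integral_deriv_of_contDiffOn_uIcc hg.contDiffOn, stieltjesIntegral]
    ring
  have hbound := norm_integral_le_of_norm_le_const (a := α) (b := β) (C := L * (N β - N α))
    (f := fun φ => (N β - N φ) * deriv g φ) fun φ hφ => by
      rw [uIoc_of_le hαβ] at hφ
      rw [norm_mul, mul_comm, Real.norm_of_nonneg (sub_nonneg.2 (hN hφ.2))]
      exact mul_le_mul (hL φ (Ioc_subset_Icc_self hφ)) (by linarith [hN hφ.1.le])
        (sub_nonneg.2 (hN hφ.2)) ((abs_nonneg _).trans (hL φ (Ioc_subset_Icc_self hφ)))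
  rw [Real.norm_eq_abs, abs_of_nonneg (sub_nonneg.2 hαβ)] at hbound
  linarith [(abs_le.1 hbound).1, mul_nonneg (sub_nonneg.2 (hN hαβ)) hg0]

theorem stieltjesIntegral_nonneg (hN : Monotone N) (hg : ContDiff ℝ 1 g) (hg0 : ∀ x, 0 ≤ g x)
    (hαβ : α ≤ β) : 0 ≤ stieltjesIntegral N g α β := by
  have hNi : ∀ a b, IntervalIntegrable N volume a b := fun a b => hN.intervalIntegrable
  obtain ⟨L, hL⟩ := (isCompact_Icc (a := α - 1) (b := β + 1)).exists_bound_of_continuousOn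
    hg.continuous_deriv_one.continuousOn
  -- Over an interval shorter than `ε / L` the increment of `ε * N` compensates the negative part.
  have hcompensated : ∀ ε > 0, ε * N α ≤ stieltjesIntegral N g α β + ε * N β := fun ε hε => by
    have hmono := le_of_forall_eventually_straddle_le
      (ψ := fun x => stieltjesIntegral N g α x + ε * N x) hαβ fun θ hθ => by
        have hlen : ∀ᶠ p in straddle θ, L * (p.2 - p.1) < ε := by
          refine (((tendsto_snd_straddle θ).sub
            (tendsto_fst_straddle θ)).const_mul L).eventually_lt_const ?_
          rwa [sub_self, mul_zero]
        filter_upwards [hlen, eventually_straddle_fst_le_and_le_snd θ,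
          (tendsto_fst_straddle θ).eventually_const_lt (show α - 1 < θ by linarith [hθ.1]),
          (tendsto_snd_straddle θ).eventually_lt_const (show θ < β + 1 by linarith [hθ.2])]
          with p hpε hp hpα hpβ
        have hle := hp.1.trans hp.2
        have hstep := neg_mul_sub_mul_sub_le_stieltjesIntegral hN hg (hg0 p.1) hle
          fun x hx => hL x ⟨hpα.le.trans hx.1, hx.2.trans hpβ.le⟩
        have hgain := mul_nonneg (sub_nonneg.2 (hN hle)) (sub_nonneg.2 hpε.le)
        linarith [stieltjesIntegral_add_adjacent (hNi α p.1) (hNi p.1 p.2) hg]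
    simpa [stieltjesIntegral] using hmono
  have hlim : Tendsto (fun ε => stieltjesIntegral N g α β + ε * N β - ε * N α) (𝓝[>] 0)
      (𝓝 (stieltjesIntegral N g α β + 0 * N β - 0 * N α)) :=
    Continuous.tendsto' (by fun_prop) _ _ rfl |>.mono_left nhdsWithin_le_nhds
  rw [zero_mul, zero_mul, add_zero, sub_zero] at hlim
  refine ge_of_tendsto hlim ?_
  filter_upwards [self_mem_nhdsWithin] with ε hε
  exact sub_nonneg.2 (hcompensated ε hε)

theorem stieltjesIntegral_le_mul_sub {K : ℝ} (hN : Monotone N) (hg : ContDiff ℝ 1 g)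
    (hgK : ∀ x, g x ≤ K) (hαβ : α ≤ β) : stieltjesIntegral N g α β ≤ K * (N β - N α) := by
  have h := stieltjesIntegral_nonneg hN (contDiff_const.sub hg) (fun x => sub_nonneg.2 (hgK x)) hαβ
  simp only [stieltjesIntegral, deriv_const_sub, mul_neg, integral_neg] at h ⊢
  linarith

theorem abs_stieltjesIntegral_le {B : ℝ} (hg : ContDiff ℝ 1 g) (hαβ : α ≤ β)
    (hB : ∀ x ∈ Icc α β, |N x| ≤ B) :
    |stieltjesIntegral N g α β| ≤ B * (|g β| + |g α| + ∫ φ in α..β, |deriv g φ|) := by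
  have hend : ∀ x ∈ Icc α β, |N x * g x| ≤ B * |g x| := fun x hx => by
    rw [abs_mul]; exact mul_le_mul_of_nonneg_right (hB x hx) (abs_nonneg _)
  have hint : |∫ φ in α..β, N φ * deriv g φ| ≤ ∫ φ in α..β, B * |deriv g φ| := by
    refine norm_integral_le_of_norm_le (f := fun φ => N φ * deriv g φ) hαβ
      (Eventually.of_forall fun x hx => ?_)
      ((hg.continuous_deriv_one.abs.const_mul B).intervalIntegrable _ _)
    rw [norm_mul]
    exact mul_le_mul_of_nonneg_right (hB x (Ioc_subset_Icc_self hx)) (norm_nonneg _)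
  rw [integral_const_mul] at hint
  calc |stieltjesIntegral N g α β|
      ≤ |N β * g β| + |N α * g α| + |∫ φ in α..β, N φ * deriv g φ| :=
        (abs_sub _ _).trans (add_le_add_left (abs_sub _ _) _)
    _ ≤ B * |g β| + B * |g α| + B * ∫ φ in α..β, |deriv g φ| :=
        add_le_add (add_le_add (hend β (right_mem_Icc.2 hαβ)) (hend α (left_mem_Icc.2 hαβ))) hint
    _ = _ := by ring

theorem integral_abs_deriv_of_nonpos (hg : ContDiff ℝ 1 g) (hαβ : α ≤ β)
    (hg' : ∀ x ∈ Icc α β, deriv g x ≤ 0) : ∫ φ in α..β, |deriv g φ| = g α - g β := by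
  rw [← neg_sub, ← integral_deriv_of_contDiffOn_uIcc hg.contDiffOn, ← integral_neg]
  refine integral_congr fun x hx => abs_of_nonpos (hg' x ?_)
  rwa [uIcc_of_le hαβ] at hx

theorem stieltjesIntegral_nonneg_of_deriv_nonpos (hg : 0 ≤ g β) (hαβ : α ≤ β) (hN0 : N α = 0)
    (hN : ∀ x ∈ Icc α β, 0 ≤ N x) (hg' : ∀ x ∈ Icc α β, deriv g x ≤ 0) :
    0 ≤ stieltjesIntegral N g α β := by
  have hint : 0 ≤ ∫ φ in α..β, -(N φ * deriv g φ) :=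
    integral_nonneg hαβ fun x hx => neg_nonneg.2 (mul_nonpos_of_nonneg_of_nonpos (hN x hx)
      (hg' x hx))
  rw [integral_neg] at hint
  rw [stieltjesIntegral, hN0]
  linarith [mul_nonneg (hN β (right_mem_Icc.2 hαβ)) hg]

end stieltjes

/-! ### Henstock–Kurzweil primitives -/

section boxes

open BoxIntegral

variable {f : ℝ → ℝ} {a b c : ℝ}

theorem ivl_lower_upper (J : Box (Fin 1)) :
    ivl (J.lower 0) (J.upper 0) (J.lower_lt_upper 0) = J := by
  ext x
  simp only [ivl, Box.mem_def, Fin.forall_fin_one]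

theorem ivl_le_ivl_iff {l u : ℝ} (hab : a < b) (hlu : l < u) :
    ivl l u hlu ≤ ivl a b hab ↔ a ≤ l ∧ u ≤ b := by
  simp only [Box.le_iff_bounds, ivl, Pi.le_def, forall_const]

theorem Icc_subset_closedBall_iff {J : Box (Fin 1)} {x : Fin 1 → ℝ} {ρ : ℝ} (hρ : 0 ≤ ρ) :
    Box.Icc J ⊆ Metric.closedBall x ρ ↔ x 0 - ρ ≤ J.lower 0 ∧ J.upper 0 ≤ x 0 + ρ := by
  constructor
  · intro h
    have hl := (dist_le_pi_dist _ _ 0).trans (h J.lower_mem_Icc)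
    have hu := (dist_le_pi_dist _ _ 0).trans (h J.upper_mem_Icc)
    rw [Real.dist_eq, abs_le] at hl hu
    constructor <;> linarith [hl.1, hu.2]
  · rintro ⟨hl, hu⟩ y hy
    refine (dist_pi_le_iff hρ).2 fun i => ?_
    rw [Subsingleton.elim i 0, Real.dist_eq, abs_le]
    constructor <;> linarith [hy.1 0, hy.2 0]

theorem volume_apply_fin_one (J : Box (Fin 1)) (x : ℝ) :
    BoxAdditiveMap.volume J x = x * (J.upper 0 - J.lower 0) := by
  simp [BoxAdditiveMap.volume_apply, mul_comm]

theorem splitLower_ivl (hab : a < b) (hbc : b < c) :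
    (ivl a c (hab.trans hbc)).splitLower 0 b = ivl a b hab := by
  rw [Box.splitLower_def (x := b) ⟨hab, hbc⟩]
  congr 2
  exact funext fun i => by rw [Subsingleton.elim i 0, Function.update_self]

theorem splitUpper_ivl (hab : a < b) (hbc : b < c) :
    (ivl a c (hab.trans hbc)).splitUpper 0 b = ivl b c hbc := by
  rw [Box.splitUpper_def (x := b) ⟨hab, hbc⟩]
  congr 2
  exact funext fun i => by rw [Subsingleton.elim i 0, Function.update_self]

theorem hkIntegral_lower_upper (f : ℝ → ℝ) (J : Box (Fin 1)) :
    hkIntegral f (J.lower 0) (J.upper 0) = integral J IntegrationParams.Henstock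
      (fun x : Fin 1 → ℝ => f (x 0)) BoxAdditiveMap.volume := by
  rw [hkIntegral, dif_pos (J.lower_lt_upper 0), ivl_lower_upper]

theorem hkIntegral_of_not_lt (f : ℝ → ℝ) (hab : ¬a < b) : hkIntegral f a b = 0 :=
  dif_neg hab

theorem hkIntegral_add (hab : a < b) (hbc : b < c) (hf : HKIntegrable f a c) :
    hkIntegral f a b + hkIntegral f b c = hkIntegral f a c := by
  obtain ⟨hac, hi⟩ := hf
  have hsplit := hi.toBoxAdditive.map_split_add le_rfl 0 b
  rw [splitLower_ivl hab hbc, splitUpper_ivl hab hbc] at hsplit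
  rwa [hkIntegral, dif_pos hab, hkIntegral, dif_pos hbc, hkIntegral, dif_pos hac]

/-- The box-additive function that maps an interval to the increment of `F` over it; it turns
telescoping sums over partitions into a library lemma on box-additive functions. -/
def incrementMap (F : ℝ → ℝ) : BoxAdditiveMap (Fin 1) ℝ ⊤ :=
  BoxAdditiveMap.ofMapSplitAdd (fun J => F (J.upper 0) - F (J.lower 0)) ⊤ fun I _ i x hx => by
    obtain rfl : i = 0 := Subsingleton.elim i 0
    have hlower := splitLower_ivl hx.1 hx.2
    have hupper := splitUpper_ivl hx.1 hx.2
    rw [ivl_lower_upper] at hlower hupper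
    rw [hlower, hupper]
    exact sub_add_sub_cancel' _ _ _

theorem sum_increment {hab : a < b} (F : ℝ → ℝ) {π : TaggedPrepartition (ivl a b hab)}
    (hπ : π.IsPartition) : ∑ J ∈ π.boxes, (F (J.upper 0) - F (J.lower 0)) = F b - F a :=
  (incrementMap F).sum_partition_boxes le_top hπ

/-- A primitive of `f`, normalized to vanish at `0`. Since `hkIntegral` is `0` when the endpoints
are in the wrong order, exactly one of the two terms contributes. -/
def hkPrimitive (f : ℝ → ℝ) (x : ℝ) : ℝ := hkIntegral f 0 x - hkIntegral f x 0

theorem hkPrimitive_sub (hf : ∀ a b : ℝ, a < b → HKIntegrable f a b) (hab : a < b) :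
    hkPrimitive f b - hkPrimitive f a = hkIntegral f a b := by
  unfold hkPrimitive
  rcases lt_trichotomy a 0 with ha | rfl | ha
  · rw [hkIntegral_of_not_lt f ha.not_gt]
    rcases lt_trichotomy b 0 with hb | rfl | hb
    · rw [hkIntegral_of_not_lt f hb.not_gt, ← hkIntegral_add hab hb (hf a 0 ha)]
      ring
    · rw [hkIntegral_of_not_lt f (lt_irrefl 0)]
      ring
    · rw [hkIntegral_of_not_lt f hb.not_gt, ← hkIntegral_add ha hb (hf a b hab)]
      ring
  · rw [hkIntegral_of_not_lt f (lt_irrefl 0), hkIntegral_of_not_lt f hab.not_gt]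
    ring
  · rw [hkIntegral_of_not_lt f ha.not_gt, hkIntegral_of_not_lt f (ha.trans hab).not_gt,
      ← hkIntegral_add ha hab (hf 0 b (ha.trans hab))]
    ring

/-- The error made on the interval `J` when the increment of `F` is replaced by the length of `J`
times the value of `f` at the tag `x`. -/
def tagError (f F : ℝ → ℝ) (x : Fin 1 → ℝ) (J : Box (Fin 1)) : ℝ :=
  f (x 0) * (J.upper 0 - J.lower 0) - (F (J.upper 0) - F (J.lower 0))

theorem sum_abs_le_of_forall_abs_sum_filter_le {ι : Type*} {s : Finset ι} {t : ι → ℝ} {C : ℝ}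
    (h : ∀ (p : ι → Prop) [DecidablePred p], |∑ i ∈ s with p i, t i| ≤ C) :
    ∑ i ∈ s, |t i| ≤ 2 * C := by
  classical
  have hpos : ∑ i ∈ s with 0 ≤ t i, |t i| = ∑ i ∈ s with 0 ≤ t i, t i :=
    Finset.sum_congr rfl fun i hi => abs_of_nonneg (Finset.mem_filter.1 hi).2
  have hneg : ∑ i ∈ s with ¬0 ≤ t i, |t i| = -∑ i ∈ s with ¬0 ≤ t i, t i := by
    rw [← Finset.sum_neg_distrib]
    exact Finset.sum_congr rfl fun i hi => abs_of_neg (not_le.1 (Finset.mem_filter.1 hi).2)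
  rw [← Finset.sum_filter_add_sum_filter_not s (fun i => 0 ≤ t i), hpos, hneg]
  linarith [(abs_le.1 (h fun i => 0 ≤ t i)).2, (abs_le.1 (h fun i => ¬0 ≤ t i)).1]

theorem henstock_memBaseSet {I : Box (Fin 1)} {c : NNReal} {r : (Fin 1 → ℝ) → Ioi (0 : ℝ)}
    {π : TaggedPrepartition I} (hr : π.IsSubordinate r) (hπ : π.IsHenstock) :
    IntegrationParams.Henstock.MemBaseSet I c r π :=
  ⟨hr, fun _ => hπ, fun h => absurd h (by decide), fun h => absurd h (by decide)⟩

theorem sum_abs_tagError_hkPrimitive_le (hf : ∀ a b : ℝ, a < b → HKIntegrable f a b)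
    (hab : a < b) {ε : ℝ} (hε : 0 < ε) :
    ∃ r : (Fin 1 → ℝ) → Ioi (0 : ℝ), ∀ π : TaggedPrepartition (ivl a b hab),
      π.IsSubordinate r → π.IsHenstock →
        ∑ J ∈ π.boxes, |tagError f (hkPrimitive f) (π.tag J) J| ≤ ε := by
  obtain ⟨_, hi⟩ := hf a b hab
  refine ⟨hi.convergenceR (ε / 2) 0, fun π hr hπ => ?_⟩
  rw [← mul_div_cancel₀ ε two_ne_zero]
  refine sum_abs_le_of_forall_abs_sum_filter_le fun p _ => ?_
  have hsum := hi.dist_integralSum_sum_integral_le_of_memBaseSet (half_pos hε)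
    ((henstock_memBaseSet (c := 0) hr hπ).filter p)
  rw [Real.dist_eq, integralSum, ← Finset.sum_sub_distrib] at hsum
  convert hsum using 3 with J
  · ext J
    simp
  · rw [← hkIntegral_lower_upper f J, ← hkPrimitive_sub hf (J.lower_lt_upper 0),
      volume_apply_fin_one]
    rfl

/-- The sums of the tag errors over the fine tagged families of disjoint subintervals of `[a, b]`
to the left of `x`. -/
def errorSums (f F : ℝ → ℝ) (hab : a < b) (r : (Fin 1 → ℝ) → Ioi (0 : ℝ)) (x : ℝ) : Set ℝ :=
  {s | ∃ π : TaggedPrepartition (ivl a b hab), π.IsSubordinate r ∧ π.IsHenstock ∧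
    (∀ J ∈ π, J.upper 0 ≤ x) ∧ ∑ J ∈ π.boxes, |tagError f F (π.tag J) J| = s}

section errorSums

variable {F : ℝ → ℝ} {hab : a < b} {r : (Fin 1 → ℝ) → Ioi (0 : ℝ)}

theorem errorSums_mono (f F : ℝ → ℝ) (hab : a < b) (r : (Fin 1 → ℝ) → Ioi (0 : ℝ)) :
    Monotone (errorSums f F hab r) := by
  rintro x y hxy s ⟨π, hr, hπ, hπx, hs⟩
  exact ⟨π, hr, hπ, fun J hJ => (hπx J hJ).trans hxy, hs⟩

theorem zero_mem_errorSums (x : ℝ) : 0 ∈ errorSums f F hab r x :=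
  ⟨⟨⊥, fun _ => (ivl a b hab).upper, fun _ => (ivl a b hab).upper_mem_Icc⟩,
    fun _ hJ => (Prepartition.notMem_bot hJ).elim, fun _ hJ => (Prepartition.notMem_bot hJ).elim,
    fun _ hJ => (Prepartition.notMem_bot hJ).elim, rfl⟩

theorem add_abs_tagError_mem_errorSums {l u θ s : ℝ} (hlu : l < u) (hal : a ≤ l) (hub : u ≤ b)
    (hθ : θ ∈ Icc l u) (hl : θ - r (fun _ => θ) ≤ l) (hu : u ≤ θ + r (fun _ => θ))
    (hs : s ∈ errorSums f F hab r l) :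
    s + |f θ * (u - l) - (F u - F l)| ∈ errorSums f F hab r u := by
  obtain ⟨π, hr, hπ, hπl, rfl⟩ := hs
  have hθI : (fun _ => θ) ∈ Box.Icc (ivl a b hab) :=
    ⟨fun _ => hal.trans hθ.1, fun _ => hθ.2.trans hub⟩
  set σ := TaggedPrepartition.single (ivl a b hab) (ivl l u hlu)
    ((ivl_le_ivl_iff hab hlu).2 ⟨hal, hub⟩) (fun _ => θ) hθI
  have hσ : ∀ J, J ∈ σ ↔ J = ivl l u hlu := fun J => Finset.mem_singleton
  have hdisj : Disjoint π.iUnion σ.iUnion := by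
    rw [Set.disjoint_left, TaggedPrepartition.iUnion_single]
    intro y hy hyl
    obtain ⟨J, hJ, hyJ⟩ := π.mem_iUnion.1 hy
    exact absurd ((hyl 0).1.trans_le ((hyJ 0).2.trans (hπl J hJ))) (lt_irrefl l)
  classical
  refine ⟨π.disjUnion σ hdisj, hr.disjUnion ((TaggedPrepartition.isSubordinate_single _ hθI).2
    ((Icc_subset_closedBall_iff (r fun _ => θ).2.le).2 ⟨hl, hu⟩)) hdisj,
    hπ.disjUnion ((TaggedPrepartition.isHenstock_single_iff _ hθI).2
      ⟨fun _ => hθ.1, fun _ => hθ.2⟩) hdisj, fun J hJ => ?_, ?_⟩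
  · rcases (TaggedPrepartition.mem_disjUnion hdisj).1 hJ with hJπ | hJσ
    · exact (hπl J hJπ).trans hlu.le
    · rw [(hσ J).1 hJσ]
      exact le_rfl
  · have hne : Disjoint π.boxes σ.boxes := Finset.disjoint_left.2 fun J hJ hJσ =>
      hlu.not_ge ((congrArg (fun I => I.upper 0) ((hσ J).1 hJσ)).ge.trans (hπl J hJ))
    rw [TaggedPrepartition.disjUnion_boxes, Finset.sum_union hne]
    congr 1
    · exact Finset.sum_congr rfl fun J hJ => by
        rw [TaggedPrepartition.disjUnion_tag_of_mem_left hdisj hJ]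
    · rw [show σ.boxes = {ivl l u hlu} from rfl, Finset.sum_singleton,
        TaggedPrepartition.disjUnion_tag_of_mem_right hdisj ((hσ _).2 rfl)]
      rfl

end errorSums

end boxes

/-- `F` is a primitive of `f` in the sense of Henstock and Kurzweil: on every bounded interval, the
error made when the increment of `F` over a small interval is replaced by the length of that
interval times the value of `f` at a point of it is dominated by the increment of a monotone
function `E` of arbitrarily small total variation. -/
def IsHKPrimitive (f F : ℝ → ℝ) : Prop :=
  ∀ a b, a ≤ b → ∀ ε > 0, ∃ E : ℝ → ℝ, Monotone E ∧ E b - E a ≤ ε ∧ ∀ θ ∈ Icc a b,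
    ∀ᶠ p in straddle θ, |f θ * (p.2 - p.1) - (F p.2 - F p.1)| ≤ E p.2 - E p.1

theorem isHKPrimitive_hkPrimitive {f : ℝ → ℝ} (hf : ∀ a b : ℝ, a < b → HKIntegrable f a b) :
    IsHKPrimitive f (hkPrimitive f) := by
  intro a b hab ε hε
  have hlt : a - 1 < b + 1 := by linarith
  obtain ⟨r, hr⟩ := sum_abs_tagError_hkPrimitive_le hf hlt hε
  set S := errorSums f (hkPrimitive f) hlt r
  have hSε : ∀ x, ∀ s ∈ S x, s ≤ ε := by
    rintro x s ⟨π, hπr, hπ, -, rfl⟩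
    exact hr π hπr hπ
  have hS0 : ∀ x, (0 : ℝ) ∈ S x := zero_mem_errorSums
  have hSb : ∀ x, BddAbove (S x) := fun x => ⟨ε, hSε x⟩
  refine ⟨fun x => sSup (S x), fun x y hxy => csSup_le_csSup (hSb y) ⟨0, hS0 x⟩
    (errorSums_mono _ _ hlt r hxy), ?_, fun θ hθ => ?_⟩
  · linarith [csSup_le ⟨0, hS0 b⟩ (hSε b), le_csSup (hSb a) (hS0 a)]
  · set ρ : ℝ := (r fun _ => θ : Ioi (0 : ℝ)).1
    have hρ : 0 < ρ := (r fun _ => θ).2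
    refine eventually_straddle_iff.2 ⟨θ - min ρ 1, by linarith [lt_min hρ one_pos],
      θ + min ρ 1, by linarith [lt_min hρ one_pos], fun l hl u hu => ?_⟩
    rcases (hl.2.trans hu.1).eq_or_lt with rfl | hlu
    · simp
    rw [le_sub_iff_add_le', ← le_sub_iff_add_le]
    refine csSup_le ⟨0, hS0 l⟩ fun s hs => le_sub_iff_add_le.2 (le_csSup (hSb u) ?_)
    have hρ1 : min ρ 1 ≤ 1 := min_le_right _ _
    have hρρ : min ρ 1 ≤ ρ := min_le_left _ _
    exact add_abs_tagError_mem_errorSums hlu (by linarith [hl.1, hθ.1]) (by linarith [hu.2, hθ.2])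
      ⟨hl.2, hu.1⟩ (by linarith [hl.1]) (by linarith [hu.2]) hs

theorem isHKPrimitive_of_hasDerivAt {f F : ℝ → ℝ} (hF : ∀ x, HasDerivAt F (f x) x) :
    IsHKPrimitive f F := by
  intro a b _ ε hε
  obtain ⟨η, hη, hηε⟩ := exists_pos_mul_lt hε (b - a)
  refine ⟨fun x => η * x, fun x y hxy => mul_le_mul_of_nonneg_left hxy hη.le, by linarith,
    fun θ _ => ?_⟩
  have hD : HasDerivAt (fun x => f θ * x - F x) 0 θ := by
    simpa using ((hasDerivAt_id θ).const_mul (f θ)).fun_sub (hF θ)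
  filter_upwards [eventually_straddle_abs_sub_le_of_hasDerivAt_zero hD hη] with p hp
  convert hp using 2 <;> ring

theorem hasDerivAt_stieltjesIntegral_sub_mul {F g : ℝ → ℝ} (hF : Continuous F)
    (hg : ContDiff ℝ 1 g) (θ : ℝ) :
    HasDerivAt (fun x => stieltjesIntegral F g 0 x - g θ * F x) 0 θ := by
  have hprod : HasDerivAt (fun x => F x * (g x - g θ)) (F θ * deriv g θ) θ := by
    rw [hasDerivAt_iff_tendsto_slope]
    refine ((hF.tendsto θ).mono_left nhdsWithin_le_nhds).mul
      (hasDerivAt_iff_tendsto_slope.1 (hg.differentiable_one θ).hasDerivAt) |>.congr fun x => ?_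
    simp only [slope_def_field]
    ring
  have hint : HasDerivAt (fun x => ∫ φ in (0 : ℝ)..x, F φ * deriv g φ) (F θ * deriv g θ) θ :=
    (hF.mul hg.continuous_deriv_one).integral_hasStrictDerivAt 0 θ |>.hasDerivAt
  have hD := (hprod.fun_sub hint).sub_const (F 0 * g 0)
  rw [sub_self] at hD
  refine hD.congr_of_eventuallyEq (Eventually.of_forall fun x => ?_)
  simp only [stieltjesIntegral]
  ring

namespace IsHKPrimitive

variable {f F : ℝ → ℝ}

theorem neg (hF : IsHKPrimitive f F) : IsHKPrimitive (fun x => -f x) fun x => -F x := by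
  intro a b hab ε hε
  obtain ⟨E, hE, hEε, herr⟩ := hF a b hab ε hε
  refine ⟨E, hE, hEε, fun θ hθ => ?_⟩
  filter_upwards [herr θ hθ] with p hp
  rw [← abs_neg] at hp
  convert hp using 2
  ring

theorem comp_add_right (hF : IsHKPrimitive f F) (c : ℝ) :
    IsHKPrimitive (fun x => f (x + c)) fun x => F (x + c) := by
  intro a b hab ε hε
  obtain ⟨E, hE, hEε, herr⟩ := hF (a + c) (b + c) (add_le_add_left hab c) ε hε
  refine ⟨fun x => E (x + c), fun x y hxy => hE (add_le_add_left hxy c), hEε, fun θ hθ => ?_⟩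
  filter_upwards [(tendsto_add_const_straddle θ c).eventually
    (herr (θ + c) ⟨add_le_add_left hθ.1 c, add_le_add_left hθ.2 c⟩)] with p hp
  rwa [add_sub_add_right_eq_sub] at hp

theorem continuous (hF : IsHKPrimitive f F) : Continuous F := by
  refine continuous_iff_continuousAt.2 fun θ =>
    continuousAt_of_forall_eventually_straddle fun ε hε => ?_
  obtain ⟨E, hE, hEε, herr⟩ := hF (θ - 1) (θ + 1) (by linarith) (ε / 2) (half_pos hε)
  have hsmall : ∀ᶠ p in straddle θ, |f θ * (p.2 - p.1)| < ε / 2 := by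
    refine (((tendsto_snd_straddle θ).sub
      (tendsto_fst_straddle θ)).const_mul (f θ)).abs.eventually_lt_const ?_
    simpa using hε
  filter_upwards [herr θ ⟨by linarith, by linarith⟩, hsmall,
    (tendsto_fst_straddle θ).eventually_const_lt (sub_one_lt θ),
    (tendsto_snd_straddle θ).eventually_lt_const (lt_add_one θ)] with p hp hpf hp1 hp2
  rw [abs_le] at hp
  rw [abs_lt] at hpf ⊢
  constructor <;> linarith [hE hp1.le, hE hp2.le, hp.1, hp.2, hpf.1, hpf.2]

/-- Integration by parts: at a tag `θ` the error for `f * g` is `g θ` times the error for `f` up to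
the increment of a function whose derivative vanishes at `θ`. -/
theorem mul (hF : IsHKPrimitive f F) {g : ℝ → ℝ} (hg : ContDiff ℝ 1 g) :
    IsHKPrimitive (fun x => f x * g x) (stieltjesIntegral F g 0) := by
  intro a b hab ε hε
  obtain ⟨G, hG⟩ := (isCompact_Icc (a := a) (b := b)).exists_bound_of_continuousOn
    hg.continuous.continuousOn
  have hG0 : 0 ≤ G := (norm_nonneg _).trans (hG a ⟨le_rfl, hab⟩)
  obtain ⟨η, hη, hηε⟩ := exists_pos_mul_lt hε (G + (b - a))
  obtain ⟨E, hE, hEη, herr⟩ := hF a b hab η hη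
  refine ⟨fun x => G * E x + η * x, fun x y hxy => add_le_add
    (mul_le_mul_of_nonneg_left (hE hxy) hG0) (mul_le_mul_of_nonneg_left hxy hη.le), ?_,
    fun θ hθ => ?_⟩
  · linarith [mul_le_mul_of_nonneg_left hEη hG0]
  · filter_upwards [herr θ hθ, eventually_straddle_abs_sub_le_of_hasDerivAt_zero
      (hasDerivAt_stieltjesIntegral_sub_mul hF.continuous hg θ) hη] with p hp hpD
    have hpg : |g θ * (f θ * (p.2 - p.1) - (F p.2 - F p.1))| ≤ G * (E p.2 - E p.1) := by
      rw [abs_mul]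
      exact mul_le_mul (hG θ hθ) hp (abs_nonneg _) hG0
    rw [abs_le] at hpD hpg ⊢
    constructor <;> linarith [hpD.1, hpD.2, hpg.1, hpg.2]

theorem hasIntegral (hF : IsHKPrimitive f F) {a b : ℝ} (hab : a < b) :
    BoxIntegral.HasIntegral (ivl a b hab) BoxIntegral.IntegrationParams.Henstock
      (fun x : Fin 1 → ℝ => f (x 0)) BoxIntegral.BoxAdditiveMap.volume (F b - F a) := by
  refine BoxIntegral.hasIntegral_iff.2 fun ε hε => ?_
  obtain ⟨E, -, hEε, herr⟩ := hF a b hab.le ε hε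
  have hball : ∀ θ, ∃ ρ > 0, θ ∈ Icc a b → ∀ l ∈ Icc (θ - ρ) θ, ∀ u ∈ Icc θ (θ + ρ),
      |f θ * (u - l) - (F u - F l)| ≤ E u - E l := fun θ => by
    by_cases hθ : θ ∈ Icc a b
    · obtain ⟨l₀, hl₀, u₀, hu₀, h⟩ := eventually_straddle_iff.1 (herr θ hθ)
      refine ⟨min (θ - l₀) (u₀ - θ), lt_min (sub_pos.2 hl₀) (sub_pos.2 hu₀), fun _ l hl u hu =>
        h l ⟨?_, hl.2⟩ u ⟨hu.1, ?_⟩⟩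
      · linarith [hl.1, min_le_left (θ - l₀) (u₀ - θ)]
      · linarith [hu.2, min_le_right (θ - l₀) (u₀ - θ)]
    · exact ⟨1, one_pos, fun h => absurd h hθ⟩
  choose ρ hρ hρerr using hball
  refine ⟨fun _ x => ⟨ρ (x 0), hρ (x 0)⟩,
    fun _ => BoxIntegral.IntegrationParams.rCond_of_bRiemann_eq_false _ rfl, fun c π hπ hπp => ?_⟩
  have hterm : ∀ J ∈ π.boxes, |tagError f F (π.tag J) J| ≤ E (J.upper 0) - E (J.lower 0) := by
    intro J hJ
    have htag := hπ.isHenstock rfl J hJ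
    have hsub := (Icc_subset_closedBall_iff (hρ (π.tag J 0)).le).1 (hπ.isSubordinate J hJ)
    exact hρerr (π.tag J 0) ⟨(π.tag_mem_Icc J).1 0, (π.tag_mem_Icc J).2 0⟩ _
      ⟨hsub.1, htag.1 0⟩ _ ⟨htag.2 0, hsub.2⟩
  calc dist (BoxIntegral.integralSum _ _ π) (F b - F a)
      = |∑ J ∈ π.boxes, tagError f F (π.tag J) J| := by
        rw [Real.dist_eq, BoxIntegral.integralSum, ← sum_increment F hπp, ← Finset.sum_sub_distrib]
        simp only [volume_apply_fin_one, tagError]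
    _ ≤ ∑ J ∈ π.boxes, (E (J.upper 0) - E (J.lower 0)) :=
        (Finset.abs_sum_le_sum_abs _ _).trans (Finset.sum_le_sum hterm)
    _ = E b - E a := sum_increment E hπp
    _ ≤ ε := hEε

theorem hkIntegrable (hF : IsHKPrimitive f F) {a b : ℝ} (hab : a < b) : HKIntegrable f a b :=
  ⟨hab, (hF.hasIntegral hab).integrable⟩

theorem hkIntegral_eq (hF : IsHKPrimitive f F) {a b : ℝ} (hab : a < b) :
    hkIntegral f a b = F b - F a := by
  rw [hkIntegral, dif_pos hab, (hF.hasIntegral hab).integral_eq]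

theorem exists_add_period_eq (hF : IsHKPrimitive f F) {T : ℝ} (hfT : Function.Periodic f T) :
    ∃ c, ∀ x, F (x + T) = F x + c := by
  have hshift : IsHKPrimitive f fun x => F (x + T) := by
    simpa only [hfT _] using hF.comp_add_right T
  have hconst : ∀ x y, x < y → F (y + T) - F y = F (x + T) - F x := fun x y hxy => by
    linarith [hF.hkIntegral_eq hxy, hshift.hkIntegral_eq hxy]
  refine ⟨F (0 + T) - F 0, fun x => ?_⟩
  rcases lt_trichotomy x 0 with hx | rfl | hx
  · linarith [hconst x 0 hx]
  · ring
  · linarith [hconst 0 x hx]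

end IsHKPrimitive

/-! ### The Poisson kernel -/

section poissonKer

open MeasureTheory (volume)

variable {r : ℝ}

theorem poissonKer_denom_pos (hr0 : 0 ≤ r) (hr1 : r < 1) (θ : ℝ) :
    0 < 1 - 2 * r * Real.cos θ + r ^ 2 := by
  nlinarith [mul_le_mul_of_nonneg_left (Real.cos_le_one θ) hr0, sq_pos_of_pos (sub_pos.2 hr1)]

theorem poissonKer_nonneg (hr0 : 0 ≤ r) (hr1 : r < 1) (θ : ℝ) : 0 ≤ poissonKer r θ :=
  div_nonneg (by nlinarith) (mul_nonneg Real.two_pi_pos.le (poissonKer_denom_pos hr0 hr1 θ).le)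

theorem poissonKer_le_poissonKer_zero (hr0 : 0 ≤ r) (hr1 : r < 1) (θ : ℝ) :
    poissonKer r θ ≤ poissonKer r 0 := by
  have hpos := poissonKer_denom_pos hr0 hr1 0
  have hr2 : 0 ≤ 1 - r ^ 2 := by nlinarith
  unfold poissonKer
  gcongr
  rw [Real.cos_zero]
  exact Real.cos_le_one θ

theorem poissonKer_zero_le (hr1 : r < 1) : poissonKer r 0 ≤ 1 / (2 * (1 - r)) := by
  have hr : 0 < 1 - r := sub_pos.2 hr1
  rw [poissonKer, Real.cos_zero, show 1 - 2 * r * 1 + r ^ 2 = (1 - r) ^ 2 by ring,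
    div_le_div_iff₀ (by positivity) (by positivity)]
  nlinarith [Real.pi_gt_three, pow_pos hr 2]

theorem poissonKer_periodic (r : ℝ) : Function.Periodic (poissonKer r) (2 * Real.pi) := fun θ => by
  simp only [poissonKer, Real.cos_periodic θ]

theorem poissonKer_even (r : ℝ) : Function.Even (poissonKer r) := fun θ => by
  simp only [poissonKer, Real.cos_neg]

theorem contDiff_poissonKer (hr0 : 0 ≤ r) (hr1 : r < 1) : ContDiff ℝ 1 (poissonKer r) :=
  contDiff_const.div (contDiff_const.mul ((contDiff_const.sub
    (contDiff_const.mul Real.contDiff_cos)).add contDiff_const)) fun θ =>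
      (mul_pos Real.two_pi_pos (poissonKer_denom_pos hr0 hr1 θ)).ne'

theorem contDiff_poissonKer_sub (hr0 : 0 ≤ r) (hr1 : r < 1) (θ : ℝ) :
    ContDiff ℝ 1 fun φ => poissonKer r (φ - θ) :=
  (contDiff_poissonKer hr0 hr1).comp (contDiff_id.sub contDiff_const)

theorem deriv_poissonKer_nonpos (hr0 : 0 ≤ r) (hr1 : r < 1) {θ : ℝ} (hθ : θ ∈ Icc 0 Real.pi) :
    deriv (poissonKer r) θ ≤ 0 := by
  have hden : HasDerivAt (fun θ => 2 * Real.pi * (1 - 2 * r * Real.cos θ + r ^ 2))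
      (2 * Real.pi * (2 * r * Real.sin θ)) θ := by
    simpa using (((((Real.hasDerivAt_cos θ).const_mul (2 * r)).const_sub 1).add_const
      (r ^ 2)).const_mul (2 * Real.pi))
  have hpos := poissonKer_denom_pos hr0 hr1 θ
  have hsin := Real.sin_nonneg_of_mem_Icc hθ
  have hr2 : 0 ≤ 1 - r ^ 2 := by nlinarith
  have hderiv : HasDerivAt (poissonKer r) _ θ :=
    (hasDerivAt_const θ (1 - r ^ 2)).fun_div hden (by positivity)
  rw [hderiv.deriv, zero_mul, zero_sub, neg_div]
  exact neg_nonpos.2 (by positivity)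

theorem tendsto_poissonKer_nhdsLT_one {δ : ℝ} (hδ : Real.cos δ ≠ 1) :
    Tendsto (fun r => poissonKer r δ) (𝓝[<] 1) (𝓝 0) := by
  have hden : 2 * Real.pi * (1 - 2 * 1 * Real.cos δ + 1 ^ 2) ≠ 0 :=
    mul_ne_zero Real.two_pi_pos.ne' fun h => hδ (by linarith)
  have hcont : ContinuousAt (fun r => poissonKer r δ) 1 :=
    ContinuousAt.div (by fun_prop) (by fun_prop) hden
  refine (hcont.tendsto.mono_left nhdsWithin_le_nhds).trans_eq ?_
  simp [poissonKer]

theorem integral_abs_deriv_poissonKer_sub (hr0 : 0 ≤ r) (hr1 : r < 1) (a θ : ℝ) :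
    ∫ φ in a..a + 2 * Real.pi, |deriv (fun φ => poissonKer r (φ - θ)) φ| =
      2 * (poissonKer r 0 - poissonKer r Real.pi) := by
  set g' : ℝ → ℝ := fun t => |deriv (poissonKer r) t|
  have hg := contDiff_poissonKer hr0 hr1
  have hcont : Continuous g' := hg.continuous_deriv_one.abs
  have hper : Function.Periodic g' (2 * Real.pi) := fun t => by
    simp only [g', ← deriv_comp_add_const, poissonKer_periodic r _]
  have heven : ∀ t, g' (-t) = g' t := fun t => by
    have := deriv_comp_neg (poissonKer r) t
    simp only [poissonKer_even r _] at this
    simp only [g', this, abs_neg]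
  have hright : ∫ t in (0 : ℝ)..Real.pi, g' t = poissonKer r 0 - poissonKer r Real.pi :=
    integral_abs_deriv_of_nonpos hg Real.pi_pos.le fun t ht => deriv_poissonKer_nonpos hr0 hr1 ht
  have hleft : ∫ t in -Real.pi..0, g' t = poissonKer r 0 - poissonKer r Real.pi := by
    rw [← hright, ← intervalIntegral.integral_congr fun t _ => heven t,
      intervalIntegral.integral_comp_neg, neg_neg, neg_zero]
  calc ∫ φ in a..a + 2 * Real.pi, |deriv (fun φ => poissonKer r (φ - θ)) φ|
      = ∫ t in a - θ..a - θ + 2 * Real.pi, g' t := by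
        simp only [deriv_comp_sub_const, g', sub_add_eq_add_sub,
          ← intervalIntegral.integral_comp_sub_right (fun t => |deriv (poissonKer r) t|)]
    _ = ∫ t in -Real.pi..Real.pi, g' t := by
        rw [hper.intervalIntegral_add_eq _ (-Real.pi), neg_add_eq_sub, two_mul,
          add_sub_cancel_right]
    _ = _ := by
        rw [← intervalIntegral.integral_add_adjacent_intervals (hcont.intervalIntegrable _ 0)
          (hcont.intervalIntegrable 0 _), hleft, hright, two_mul]

theorem abs_stieltjesIntegral_poissonKer_le {N : ℝ → ℝ} {B : ℝ} (hr0 : 0 ≤ r) (hr1 : r < 1)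
    (θ : ℝ) (hB : ∀ x ∈ Icc 0 (2 * Real.pi), |N x| ≤ B) :
    |stieltjesIntegral N (fun φ => poissonKer r (φ - θ)) 0 (2 * Real.pi)| ≤ 2 * B / (1 - r) := by
  have hB0 : 0 ≤ B := (abs_nonneg _).trans (hB 0 ⟨le_rfl, Real.two_pi_pos.le⟩)
  have habs : ∀ t, |poissonKer r t| ≤ poissonKer r 0 := fun t => by
    rw [abs_of_nonneg (poissonKer_nonneg hr0 hr1 t)]
    exact poissonKer_le_poissonKer_zero hr0 hr1 t
  have hvar := integral_abs_deriv_poissonKer_sub hr0 hr1 0 θ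
  rw [zero_add] at hvar
  calc _ ≤ B * (|poissonKer r (2 * Real.pi - θ)| + |poissonKer r (0 - θ)| +
        ∫ φ in 0..2 * Real.pi, |deriv (fun φ => poissonKer r (φ - θ)) φ|) :=
        abs_stieltjesIntegral_le (contDiff_poissonKer_sub hr0 hr1 θ) Real.two_pi_pos.le hB
    _ ≤ B * (4 * (1 / (2 * (1 - r)))) := by
        refine mul_le_mul_of_nonneg_left ?_ hB0
        linarith [habs (2 * Real.pi - θ), habs (0 - θ), poissonKer_nonneg hr0 hr1 Real.pi,
          poissonKer_zero_le hr1]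
    _ = 2 * B / (1 - r) := by
        have := sub_pos.2 hr1
        field_simp
        norm_num

theorem norm_circleMap_sub_sq (R r θ φ : ℝ) :
    ‖circleMap 0 R φ - r * Complex.exp (θ * Complex.I)‖ ^ 2 =
      R ^ 2 - 2 * R * r * Real.cos (φ - θ) + r ^ 2 := by
  rw [← Complex.normSq_eq_norm_sq, Complex.normSq_apply, Real.cos_sub]
  simp only [circleMap, zero_add, Complex.sub_re, Complex.sub_im, Complex.re_ofReal_mul,
    Complex.im_ofReal_mul, Complex.exp_ofReal_mul_I_re, Complex.exp_ofReal_mul_I_im]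
  linear_combination R ^ 2 * Real.sin_sq_add_cos_sq φ + r ^ 2 * Real.sin_sq_add_cos_sq θ

theorem poissonKernel_circleMap_eq {R : ℝ} (hR : R ≠ 0) (r θ φ : ℝ) :
    poissonKernel 0 (r * Complex.exp (θ * Complex.I)) (circleMap 0 R φ) =
      2 * Real.pi * poissonKer (r / R) (φ - θ) := by
  have hden : R ^ 2 - 2 * R * r * Real.cos (φ - θ) + r ^ 2 =
      R ^ 2 * (1 - 2 * (r / R) * Real.cos (φ - θ) + (r / R) ^ 2) := by
    field_simp
  simp only [poissonKernel_def, sub_zero, norm_circleMap_sub_sq, hden, norm_mul,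
    Complex.norm_exp_ofReal_mul_I, norm_circleMap_zero, Complex.norm_real, Real.norm_eq_abs,
    sq_abs, mul_one, poissonKer]
  rw [show R ^ 2 - r ^ 2 = R ^ 2 * (1 - (r / R) ^ 2) by field_simp,
    mul_div_mul_left _ _ (pow_ne_zero 2 hR),
    mul_div (2 * Real.pi), mul_div_mul_left _ _ Real.two_pi_pos.ne']

theorem eq_integral_poissonKer {u : ℂ → ℝ} {R r θ : ℝ}
    (hu : HarmonicOnNhd u (Metric.closedBall 0 R)) (hr0 : 0 ≤ r) (hr : r < R) :
    u (r * Complex.exp (θ * Complex.I)) =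
      ∫ φ in (0 : ℝ)..2 * Real.pi, u (circleMap 0 R φ) * poissonKer (r / R) (φ - θ) := by
  have hmem : r * Complex.exp (θ * Complex.I) ∈ Metric.ball (0 : ℂ) R := by
    rwa [mem_ball_zero_iff, norm_mul, Complex.norm_exp_ofReal_mul_I, mul_one, Complex.norm_real,
      Real.norm_of_nonneg hr0]
  rw [← hu.circleAverage_poissonKernel_smul hmem, Real.circleAverage, smul_eq_mul,
    ← intervalIntegral.integral_const_mul]
  refine intervalIntegral.integral_congr fun φ _ => ?_
  simp only [Pi.smul_apply', smul_eq_mul, poissonKernel_circleMap_eq (hr0.trans_lt hr).ne']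
  field_simp

theorem integral_poissonKer_sub (hr0 : 0 ≤ r) (hr1 : r < 1) (a θ : ℝ) :
    ∫ φ in a..a + 2 * Real.pi, poissonKer r (φ - θ) = 1 := by
  rw [((poissonKer_periodic r).sub_const θ).intervalIntegral_add_eq a 0, zero_add]
  simpa using (eq_integral_poissonKer (θ := θ) (harmonicOnNhd_const (1 : ℝ)) hr0 hr1).symm

end poissonKer

/-! ### Poisson–Stieltjes integrals -/

section poissonStieltjes

open MeasureTheory (volume)

/-- The Poisson–Stieltjes integral `P[dN](z) = (2π)⁻¹ ∫ P(z, e^{iφ}) dN(φ)`, over `0 ≤ φ ≤ 2π`. -/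
def poissonStieltjes (N : ℝ → ℝ) (z : ℂ) : ℝ :=
  stieltjesIntegral N (fun φ => (2 * Real.pi)⁻¹ * poissonKernel 0 z (circleMap 0 1 φ)) 0
    (2 * Real.pi)

theorem poissonStieltjes_polar (N : ℝ → ℝ) (r θ : ℝ) :
    poissonStieltjes N (r * Complex.exp (θ * Complex.I)) =
      stieltjesIntegral N (fun φ => poissonKer r (φ - θ)) 0 (2 * Real.pi) := by
  simp only [poissonStieltjes, poissonKernel_circleMap_eq one_ne_zero, div_one,
    inv_mul_cancel_left₀ Real.two_pi_pos.ne']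

theorem exists_forall_circleMap_eq {E : Type*} (N : ℝ → E) :
    ∃ f : ℂ → E, ∀ φ ∈ Ioc 0 (2 * Real.pi), f (circleMap 0 1 φ) = N φ := by
  refine ⟨fun ζ => N (toIocMod Real.two_pi_pos 0 ζ.arg), fun φ hφ => congrArg N ?_⟩
  rw [circleMap_zero, Complex.ofReal_one, one_mul, Complex.arg_exp_mul_I, toIocMod_eq_iff, zero_add]
  exact ⟨hφ, -toIocDiv Real.two_pi_pos (-Real.pi) φ, by
    rw [toIocMod, neg_zsmul, sub_eq_add_neg]⟩

variable {z : ℂ}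

theorem circleMap_sub_ne_zero (hz : ‖z‖ < 1) (φ : ℝ) : circleMap 0 1 φ - z ≠ 0 :=
  sub_ne_zero.2 (circleMap_ne_mem_ball (mem_ball_zero_iff.2 hz) φ)

theorem hasDerivAt_poissonKernel_circleMap (hz : ‖z‖ < 1) (φ : ℝ) :
    HasDerivAt (fun φ => poissonKernel 0 z (circleMap 0 1 φ))
      (-(Complex.I * z * (2 * circleMap 0 1 φ / (circleMap 0 1 φ - z) ^ 2)).re) φ := by
  have hne := circleMap_sub_ne_zero hz φ
  have hζ := hasDerivAt_circleMap 0 1 φ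
  have hH : HasDerivAt (fun φ => herglotzRieszKernel 0 z (circleMap 0 1 φ))
      (-(Complex.I * z * (2 * circleMap 0 1 φ / (circleMap 0 1 φ - z) ^ 2))) φ := by
    simp only [herglotzRieszKernel_def, sub_zero]
    refine ((hζ.add_const z).fun_div (hζ.sub_const z) hne).congr_deriv ?_
    field_simp
    ring
  rw [poissonKernel_eq_re_herglotzRieszKernel]
  exact Complex.reCLM.hasFDerivAt.comp_hasDerivAt φ hH

theorem poissonStieltjes_eq_re {N : ℝ → ℝ} {f : ℂ → ℂ}
    (hf : ∀ φ ∈ Ioc 0 (2 * Real.pi), f (circleMap 0 1 φ) = N φ)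
    (hint : CircleIntegrable f 0 1) (hz : ‖z‖ < 1) :
    poissonStieltjes N z =
      (((2 * Real.pi)⁻¹ * (N (2 * Real.pi) - N 0) : ℝ) * herglotzRieszKernel 0 z 1 +
        Complex.I * z * Real.circleAverage (fun ζ => (2 * ζ / (ζ - z) ^ 2) • f ζ) 0 1).re := by
  set K : ℂ → ℂ := fun ζ => 2 * ζ / (ζ - z) ^ 2
  have hK : ContinuousOn K (Metric.sphere 0 |1|) :=
    ContinuousOn.div (by fun_prop) (by fun_prop) fun ζ hζ => by
      refine pow_ne_zero 2 (sub_ne_zero.2 ?_)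
      rintro rfl
      simp [hz.ne] at hζ
  have hKf : IntervalIntegrable (fun φ => Complex.I * z * K (circleMap 0 1 φ) • f (circleMap 0 1 φ))
      volume 0 (2 * Real.pi) := (hint.continuousOn_smul hK).const_mul _
  have hparts : ∫ φ in (0 : ℝ)..2 * Real.pi, N φ *
        deriv (fun φ => (2 * Real.pi)⁻¹ * poissonKernel 0 z (circleMap 0 1 φ)) φ =
      -(Complex.I * z * Real.circleAverage (fun ζ => K ζ • f ζ) 0 1).re := by
    rw [Real.circleAverage_def, mul_smul_comm, ← intervalIntegral.integral_const_mul,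
      Complex.real_smul, Complex.re_ofReal_mul, ← Complex.reCLM_apply,
      ← Complex.reCLM.intervalIntegral_comp_comm hKf,
      ← intervalIntegral.integral_const_mul, ← intervalIntegral.integral_neg]
    refine intervalIntegral.integral_congr_Ioo_of_le Real.two_pi_pos.le fun φ hφ => ?_
    simp only [((hasDerivAt_poissonKernel_circleMap hz φ).const_mul _).deriv,
      hf φ (Ioo_subset_Ioc_self hφ), Complex.reCLM_apply, smul_eq_mul, ← mul_assoc,
      Complex.re_mul_ofReal, K]
    ring
  rw [poissonStieltjes, stieltjesIntegral, hparts, Complex.add_re, Complex.re_ofReal_mul,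
    poissonKernel_eq_re_herglotzRieszKernel]
  simp only [circleMap_zero, Function.comp_apply, Complex.ofReal_one, one_mul, Complex.ofReal_mul,
    Complex.ofReal_ofNat, Complex.exp_two_pi_mul_I, Complex.ofReal_zero, zero_mul, Complex.exp_zero]
  ring

theorem harmonicAt_poissonStieltjes {N : ℝ → ℝ}
    (hN : IntervalIntegrable N volume 0 (2 * Real.pi)) (hz : ‖z‖ < 1) :
    HarmonicAt (poissonStieltjes N) z := by
  obtain ⟨f, hf⟩ := exists_forall_circleMap_eq fun φ => (N φ : ℂ)
  have hN' : IntervalIntegrable (fun φ => (N φ : ℂ)) volume 0 (2 * Real.pi) :=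
    ⟨hN.1.ofReal, hN.2.ofReal⟩
  have hint : CircleIntegrable f 0 1 := hN'.congr fun φ hφ =>
    (hf φ (by rwa [uIoc_of_le Real.two_pi_pos.le] at hφ)).symm
  have hball : Metric.ball (0 : ℂ) 1 ∈ 𝓝 z := Metric.isOpen_ball.mem_nhds (mem_ball_zero_iff.2 hz)
  set G : ℂ → ℂ := fun w => Real.circleAverage (fun ζ => herglotzRieszKernel 0 w ζ • f ζ) 0 1
  have hG : AnalyticAt ℂ G z :=
    analyticOnNhd_circleAverage_herglotzRieszKernel_smul hint z (mem_ball_zero_iff.2 hz)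
  have hker : AnalyticAt ℂ (fun w => herglotzRieszKernel 0 w 1) z := by
    simp only [herglotzRieszKernel_def, sub_zero]
    refine (analyticAt_const.add analyticAt_id).div (analyticAt_const.sub analyticAt_id)
      (sub_ne_zero.2 ?_)
    rintro rfl
    simp at hz
  have heq : poissonStieltjes N =ᶠ[𝓝 z] fun w =>
      (((2 * Real.pi)⁻¹ * (N (2 * Real.pi) - N 0) : ℝ) * herglotzRieszKernel 0 w 1 +
        Complex.I * w * deriv G w).re := by
    filter_upwards [hball] with w hw
    rw [poissonStieltjes_eq_re hf hint (mem_ball_zero_iff.1 hw),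
      (hasDerivAt_circleAverage_herglotzRieszKernel_smul hint hw).deriv]
  exact (harmonicAt_congr_nhds heq).2 ((analyticAt_const.mul hker).add
    ((analyticAt_const.mul analyticAt_id).mul hG.deriv)).harmonicAt_re

end poissonStieltjes

/-! ### Radial lower limits of Poisson–Stieltjes integrals -/

section radial

open MeasureTheory (volume)

variable {r : ℝ}

theorem neg_mul_poissonKer_le_stieltjesIntegral {M : ℝ → ℝ} {C δ : ℝ} (hr0 : 0 ≤ r) (hr1 : r < 1)
    (hM : ∀ a b, IntervalIntegrable M volume a b) (hM0 : M 0 = 0) (hδ0 : 0 ≤ δ) (hδ : δ ≤ Real.pi)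
    (hnear : ∀ t ∈ Icc 0 δ, 0 ≤ M t) (hfar : ∀ t ∈ Icc δ Real.pi, |M t| ≤ C) :
    -(2 * C * poissonKer r δ) ≤ stieltjesIntegral M (poissonKer r) 0 Real.pi := by
  have hg := contDiff_poissonKer hr0 hr1
  have hg0 := poissonKer_nonneg hr0 hr1
  have hcentre : 0 ≤ stieltjesIntegral M (poissonKer r) 0 δ :=
    stieltjesIntegral_nonneg_of_deriv_nonpos (hg0 δ) hδ0 hM0 hnear fun t ht =>
      deriv_poissonKer_nonpos hr0 hr1 ⟨ht.1, ht.2.trans hδ⟩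
  have htail := abs_stieltjesIntegral_le hg hδ hfar
  rw [abs_of_nonneg (hg0 δ), abs_of_nonneg (hg0 Real.pi), integral_abs_deriv_of_nonpos hg hδ
    fun t ht => deriv_poissonKer_nonpos hr0 hr1 ⟨hδ0.trans ht.1, ht.2⟩] at htail
  rw [← stieltjesIntegral_add_adjacent (hM 0 δ) (hM δ Real.pi) hg]
  linarith [neg_abs_le (stieltjesIntegral M (poissonKer r) δ Real.pi)]

theorem eventually_neg_le_stieltjesIntegral_poissonKer {N : ℝ → ℝ} {B θ η : ℝ}
    (hN : ∀ a b, IntervalIntegrable N volume a b)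
    (hB : ∀ x ∈ Icc (θ - Real.pi) (θ + Real.pi), |N x| ≤ B)
    (hmono : ∀ᶠ p in straddle θ, N p.1 ≤ N p.2) (hη : 0 < η) :
    ∀ᶠ r in 𝓝[<] 1, -η ≤ stieltjesIntegral N (fun φ => poissonKer r (φ - θ)) (θ - Real.pi)
      (θ + Real.pi) := by
  obtain ⟨a, ha, b, hb, hab⟩ := eventually_straddle_iff.1 hmono
  obtain ⟨δ, hδ0, hδ⟩ : ∃ δ > 0, δ ≤ θ - a ∧ δ ≤ b - θ ∧ δ ≤ Real.pi :=
    ⟨min (θ - a) (min (b - θ) Real.pi), by simp [ha, hb, Real.pi_pos], by simp⟩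
  have hcos : Real.cos δ ≠ 1 := fun h =>
    hδ0.ne' ((Real.cos_eq_one_iff_of_lt_of_lt (by linarith [Real.pi_pos])
      (by linarith [Real.pi_pos])).1 h)
  have hsmall : ∀ᶠ r in 𝓝[<] 1, 2 * (2 * B) * poissonKer r δ < η := by
    have := (tendsto_poissonKer_nhdsLT_one hcos).const_mul (2 * (2 * B))
    rw [mul_zero] at this
    exact this.eventually_lt_const hη
  have hM : ∀ c d, IntervalIntegrable (fun t => N (θ + t) - N (θ - t)) volume c d := fun c d => by
    have hright := (hN (θ + c) (θ + d)).comp_add_left θ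
    have hleft := (hN (θ - c) (θ - d)).comp_sub_left θ
    simp only [add_sub_cancel_left, sub_sub_cancel] at hright hleft
    exact hright.sub hleft
  filter_upwards [hsmall, Ico_mem_nhdsLT one_pos] with r hr ⟨hr0, hr1⟩
  rw [stieltjesIntegral_symm_of_even hN (contDiff_poissonKer hr0 hr1) (poissonKer_even r)]
  refine le_trans (by linarith) (neg_mul_poissonKer_le_stieltjesIntegral (C := 2 * B) hr0 hr1 hM
    (by simp) hδ0.le hδ.2.2 (fun t ht => ?_) fun t ht => ?_)
  · exact sub_nonneg.2 (hab _ ⟨by linarith [ht.2], by linarith [ht.1]⟩ _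
      ⟨by linarith [ht.1], by linarith [ht.2]⟩)
  · have hplus := hB (θ + t) ⟨by linarith [ht.1, Real.pi_pos], by linarith [ht.2]⟩
    have hminus := hB (θ - t) ⟨by linarith [ht.2], by linarith [ht.1, Real.pi_pos]⟩
    linarith [abs_sub (N (θ + t)) (N (θ - t))]

theorem eventually_sub_le_stieltjesIntegral_poissonKer {N : ℝ → ℝ} {B θ y η : ℝ}
    (hN : ∀ a b, IntervalIntegrable N volume a b)
    (hB : ∀ x ∈ Icc (θ - Real.pi) (θ + Real.pi), |N x| ≤ B)
    (hy : ∀ᶠ p in straddle θ, y * (p.2 - p.1) ≤ N p.2 - N p.1) (hη : 0 < η) :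
    ∀ᶠ r in 𝓝[<] 1, y - η ≤ stieltjesIntegral N (fun φ => poissonKer r (φ - θ)) (θ - Real.pi)
      (θ + Real.pi) := by
  have hlin : ∀ x, HasDerivAt (fun x => -y * x) (-y) x := fun _ => hasDerivAt_const_mul (-y)
  have hlinB : ∀ x ∈ Icc (θ - Real.pi) (θ + Real.pi), |N x + -y * x| ≤
      B + |y| * (|θ| + Real.pi) := fun x hx => by
    have hx' : |x| ≤ |θ| + Real.pi := by
      rw [abs_le]
      constructor <;> linarith [hx.1, hx.2, neg_abs_le θ, le_abs_self θ]
    have := mul_le_mul_of_nonneg_left hx' (abs_nonneg y)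
    rw [← abs_neg y, ← abs_mul, abs_neg y] at this
    linarith [abs_add_le (N x) (-y * x), hB x hx]
  have hlinN : ∀ a b, IntervalIntegrable (fun x => -y * x) volume a b := fun a b =>
    (continuous_const_mul (-y)).intervalIntegrable a b
  have hmono : ∀ᶠ p in straddle θ, N p.1 + -y * p.1 ≤ N p.2 + -y * p.2 := by
    filter_upwards [hy] with p hp
    linarith
  filter_upwards [eventually_neg_le_stieltjesIntegral_poissonKer
    (fun a b => (hN a b).add (hlinN a b)) hlinB hmono hη, Ico_mem_nhdsLT one_pos]
    with r hr ⟨hr0, hr1⟩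
  have hg := contDiff_poissonKer_sub hr0 hr1 θ
  have hmass := integral_poissonKer_sub hr0 hr1 (θ - Real.pi) θ
  rw [show θ - Real.pi + 2 * Real.pi = θ + Real.pi by ring] at hmass
  rw [stieltjesIntegral_add (hN _ _) (hlinN _ _) hg,
    stieltjesIntegral_eq_integral hlin continuous_const hg, intervalIntegral.integral_const_mul,
    hmass] at hr
  linarith

end radial

/-! ### From Alexiewicz growth to pointwise growth -/

section growth

open MeasureTheory (volume)

theorem abs_hkIntegral_le_of_alexiewiczNorm_le {f : ℝ → ℝ} {C a b : ℝ} (hC : 0 ≤ C)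
    (hf : alexiewiczNorm f ≤ ENNReal.ofReal C) (hab : a < b) (hlen : b - a ≤ 2 * Real.pi) :
    |hkIntegral f a b| ≤ C := by
  rw [← ENNReal.ofReal_le_ofReal_iff hC]
  calc ENNReal.ofReal |hkIntegral f a b|
      ≤ alexiewiczNorm f := le_iSup_of_le a <| le_iSup_of_le b <| le_iSup
        (fun _ : a < b ∧ b - a ≤ 2 * Real.pi => ENNReal.ofReal |hkIntegral f a b|) ⟨hab, hlen⟩
    _ ≤ ENNReal.ofReal C := hf

variable {u : ℂ → ℝ}

theorem continuous_circleFun {R : ℝ} (hu : ContinuousOn u (Metric.closedBall 0 R)) (hR : 0 ≤ R) :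
    Continuous (circleFun u R) := by
  refine hu.comp_continuous (by fun_prop) fun φ => ?_
  rw [mem_closedBall_zero_iff, norm_mul, Complex.norm_exp_ofReal_mul_I, mul_one, Complex.norm_real,
    Real.norm_of_nonneg hR]

theorem abs_circleFun_le_of_alexiewiczNorm_le {R r C : ℝ}
    (hu : HarmonicOnNhd u (Metric.closedBall 0 R)) (hr0 : 0 ≤ r) (hr : r < R) (hC : 0 ≤ C)
    (hnorm : alexiewiczNorm (circleFun u R) ≤ ENNReal.ofReal C) (θ : ℝ) :
    |circleFun u r θ| ≤ 2 * C / (1 - r / R) := by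
  have hR := hr0.trans_lt hr
  have hcont : Continuous (circleFun u R) :=
    continuous_circleFun (fun z hz => (hu z hz).1.continuousAt.continuousWithinAt) hR.le
  set U : ℝ → ℝ := fun x => ∫ φ in (0 : ℝ)..x, circleFun u R φ
  have hU : ∀ x, HasDerivAt U (circleFun u R x) x := fun x => hcont.integral_hasStrictDerivAt 0 x
    |>.hasDerivAt
  have hU0 : U 0 = 0 := intervalIntegral.integral_same
  have hUC : ∀ x ∈ Icc 0 (2 * Real.pi), |U x| ≤ C := fun x hx => by
    rcases hx.1.eq_or_lt with rfl | hx0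
    · rwa [hU0, abs_zero]
    · have := abs_hkIntegral_le_of_alexiewiczNorm_le hC hnorm hx0 (by linarith [hx.2])
      rwa [(isHKPrimitive_of_hasDerivAt hU).hkIntegral_eq hx0, hU0, sub_zero] at this
  have hrR0 : 0 ≤ r / R := div_nonneg hr0 hR.le
  have hrR1 : r / R < 1 := (div_lt_one hR).2 hr
  have hpoisson : circleFun u r θ =
      stieltjesIntegral U (fun φ => poissonKer (r / R) (φ - θ)) 0 (2 * Real.pi) := by
    rw [stieltjesIntegral_eq_integral hU hcont (contDiff_poissonKer_sub hrR0 hrR1 θ), circleFun,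
      eq_integral_poissonKer hu hr0 hr]
    simp only [circleMap_zero, circleFun]
  rw [hpoisson]
  exact abs_stieltjesIntegral_poissonKer_le hrR0 hrR1 θ hUC

theorem eventually_alexiewiczNorm_circleFun_le {ε : ℝ}
    (hgrowth : Tendsto (fun r : ℝ => ENNReal.ofReal (1 - r) * alexiewiczNorm (circleFun u r))
      (𝓝[<] 1) (𝓝 0)) (hε : 0 < ε) :
    ∀ᶠ r in 𝓝[<] 1, alexiewiczNorm (circleFun u r) ≤ ENNReal.ofReal (ε / (1 - r)) := by
  filter_upwards [hgrowth.eventually_le_const (ENNReal.ofReal_pos.2 hε), self_mem_nhdsWithin]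
    with r hr hr1
  have hr1' : 0 < 1 - r := sub_pos.2 hr1
  rw [ENNReal.ofReal_div_of_pos hr1', ENNReal.le_div_iff_mul_le
    (.inl (ENNReal.ofReal_pos.2 hr1').ne') (.inl ENNReal.ofReal_ne_top), mul_comm]
  exact hr

theorem eventually_abs_circleFun_le_div_sq {ε : ℝ} (hu : HarmonicOnNhd u (Metric.ball 0 1))
    (hgrowth : Tendsto (fun r : ℝ => ENNReal.ofReal (1 - r) * alexiewiczNorm (circleFun u r))
      (𝓝[<] 1) (𝓝 0)) (hε : 0 < ε) :
    ∀ᶠ r in 𝓝[<] 1, ∀ θ, |circleFun u r θ| ≤ ε / (1 - r) ^ 2 := by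
  have hmid : Tendsto (fun r : ℝ => (1 + r) / 2) (𝓝[<] 1) (𝓝[<] 1) := by
    refine tendsto_nhdsWithin_iff.2 ⟨?_, ?_⟩
    · have : ContinuousAt (fun r : ℝ => (1 + r) / 2) 1 := by fun_prop
      simpa using this.tendsto.mono_left nhdsWithin_le_nhds
    · filter_upwards [self_mem_nhdsWithin] with r (hr : r < 1)
      exact mem_Iio.2 (by linarith)
  filter_upwards [hmid.eventually (eventually_alexiewiczNorm_circleFun_le hgrowth
    (show 0 < ε / 8 by positivity)), Ico_mem_nhdsLT one_pos] with r hnorm ⟨hr0, hr1⟩ θ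
  set R := (1 + r) / 2 with hR
  have hR1 : 0 < 1 - R := by linarith
  have hball : Metric.closedBall (0 : ℂ) R ⊆ Metric.ball 0 1 :=
    Metric.closedBall_subset_ball (by linarith)
  have hgap : (1 - r) / 2 ≤ 1 - r / R := by
    rw [le_sub_comm, div_le_iff₀ (by linarith)]
    nlinarith
  calc |circleFun u r θ| ≤ 2 * (ε / 8 / (1 - R)) / (1 - r / R) :=
        abs_circleFun_le_of_alexiewiczNorm_le (hu.mono hball) hr0 (by linarith) (by positivity)
          hnorm θ
    _ ≤ 2 * (ε / 8 / (1 - R)) / ((1 - r) / 2) := by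
        have : 0 < (1 - r) / 2 := by linarith
        gcongr
    _ = ε / (1 - r) ^ 2 := by
        have : 1 - r ≠ 0 := by linarith
        rw [show 1 - R = (1 - r) / 2 by linarith]
        field_simp
        norm_num

end growth

/-! ### Comparison with Poisson–Stieltjes integrals -/

section comparison

open MeasureTheory (volume)

variable {r θ c : ℝ} {E F f : ℝ → ℝ}

theorem poissonStieltjes_eq_stieltjesIntegral_period
    (hF : ∀ a b, IntervalIntegrable F volume a b) (hFT : ∀ x, F (x + 2 * Real.pi) = F x + c)
    (hr0 : 0 ≤ r) (hr1 : r < 1) (α θ : ℝ) :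
    poissonStieltjes F (r * Complex.exp (θ * Complex.I)) =
      stieltjesIntegral F (fun φ => poissonKer r (φ - θ)) (α - Real.pi) (α + Real.pi) := by
  have := stieltjesIntegral_period_eq hF hFT (contDiff_poissonKer_sub hr0 hr1 θ)
    ((poissonKer_periodic r).sub_const θ) 0 (α - Real.pi)
  rwa [zero_add, show α - Real.pi + 2 * Real.pi = α + Real.pi by ring,
    ← poissonStieltjes_polar] at this

/-- On `[0, 2π]`, a distribution function of the image on the circle of the measure `dE` restricted
to `[-2π, 2π]`. -/
def foldPeriod (E : ℝ → ℝ) (x : ℝ) : ℝ := E x + E (x - 2 * Real.pi)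

theorem monotone_foldPeriod (hE : Monotone E) : Monotone (foldPeriod E) :=
  hE.add fun _ _ h => hE (sub_le_sub_right h _)

theorem poissonStieltjes_foldPeriod (hE : Monotone E) (hr0 : 0 ≤ r) (hr1 : r < 1) (θ : ℝ) :
    poissonStieltjes (foldPeriod E) (r * Complex.exp (θ * Complex.I)) =
      stieltjesIntegral E (fun φ => poissonKer r (φ - θ)) (-(2 * Real.pi)) (2 * Real.pi) := by
  have hg := contDiff_poissonKer_sub hr0 hr1 θ
  have hper := ((poissonKer_periodic r).sub_const θ).sub_eq
  have hshift : stieltjesIntegral (fun x => E (x - 2 * Real.pi)) (fun φ => poissonKer r (φ - θ)) 0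
      (2 * Real.pi) = stieltjesIntegral E (fun φ => poissonKer r (φ - θ)) (-(2 * Real.pi)) 0 := by
    have := stieltjesIntegral_comp_add_right E (fun φ => poissonKer r (φ - θ)) 0 (2 * Real.pi)
      (-(2 * Real.pi))
    simpa only [← sub_eq_add_neg, hper _, sub_self, zero_sub] using this
  have hEshift : Monotone fun x => E (x - 2 * Real.pi) := fun _ _ h => hE (sub_le_sub_right h _)
  rw [poissonStieltjes_polar, ← stieltjesIntegral_add_adjacent (hE.intervalIntegrable (b := 0))
    hE.intervalIntegrable hg, ← hshift, add_comm]
  exact stieltjesIntegral_add hE.intervalIntegrable hEshift.intervalIntegrable hg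

theorem stieltjesIntegral_le_poissonStieltjes_foldPeriod (hE : Monotone E) (hr0 : 0 ≤ r)
    (hr1 : r < 1) {α β : ℝ} (hα : -(2 * Real.pi) ≤ α) (hβ : β ≤ 2 * Real.pi) :
    stieltjesIntegral E (fun φ => poissonKer r (φ - θ)) α β ≤
      poissonStieltjes (foldPeriod E) (r * Complex.exp (θ * Complex.I)) := by
  have hg := contDiff_poissonKer_sub hr0 hr1 θ
  have hg0 : ∀ φ, 0 ≤ poissonKer r (φ - θ) := fun φ => poissonKer_nonneg hr0 hr1 _
  have hint : ∀ a b, IntervalIntegrable E volume a b := fun _ _ => hE.intervalIntegrable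
  have hsplit_left := stieltjesIntegral_add_adjacent (hint (-(2 * Real.pi)) α)
    (hint α (2 * Real.pi)) hg
  have hsplit_right := stieltjesIntegral_add_adjacent (hint α β) (hint β (2 * Real.pi)) hg
  rw [poissonStieltjes_foldPeriod hE hr0 hr1]
  linarith [stieltjesIntegral_nonneg hE hg hg0 hα, stieltjesIntegral_nonneg hE hg hg0 hβ]

theorem poissonStieltjes_foldPeriod_nonneg (hE : Monotone E) (hr0 : 0 ≤ r) (hr1 : r < 1) (θ : ℝ) :
    0 ≤ poissonStieltjes (foldPeriod E) (r * Complex.exp (θ * Complex.I)) := by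
  rw [poissonStieltjes_foldPeriod hE hr0 hr1]
  exact stieltjesIntegral_nonneg hE (contDiff_poissonKer_sub hr0 hr1 θ)
    (fun φ => poissonKer_nonneg hr0 hr1 _) (by linarith [Real.pi_pos])

theorem poissonStieltjes_foldPeriod_le (hE : Monotone E) (hr0 : 0 ≤ r) (hr1 : r < 1) (θ : ℝ) :
    poissonStieltjes (foldPeriod E) (r * Complex.exp (θ * Complex.I)) ≤
      poissonKer r 0 * (E (2 * Real.pi) - E (-(2 * Real.pi))) := by
  rw [poissonStieltjes_foldPeriod hE hr0 hr1]
  exact stieltjesIntegral_le_mul_sub hE (contDiff_poissonKer_sub hr0 hr1 θ)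
    (fun φ => poissonKer_le_poissonKer_zero hr0 hr1 _) (by linarith [Real.pi_pos])

theorem eventually_sub_le_poissonStieltjes_add (hF : Continuous F)
    (hFT : ∀ x, F (x + 2 * Real.pi) = F x + c) (hE : Monotone E)
    (hθ : θ ∈ Ico (-Real.pi) Real.pi) {y η : ℝ}
    (hy : ∀ᶠ p in straddle θ, y * (p.2 - p.1) ≤ (F p.2 + E p.2) - (F p.1 + E p.1)) (hη : 0 < η) :
    ∀ᶠ r : ℝ in 𝓝[<] 1, y - η ≤ poissonStieltjes F (r * Complex.exp (θ * Complex.I)) +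
      poissonStieltjes (foldPeriod E) (r * Complex.exp (θ * Complex.I)) := by
  have hFint : ∀ a b, IntervalIntegrable F volume a b := hF.intervalIntegrable
  have hEint : ∀ a b, IntervalIntegrable E volume a b := fun _ _ => hE.intervalIntegrable
  obtain ⟨B, hB⟩ := isCompact_Icc.exists_bound_of_continuousOn
    (hF.continuousOn (s := Icc (θ - Real.pi) (θ + Real.pi)))
  have hbound : ∀ x ∈ Icc (θ - Real.pi) (θ + Real.pi), |F x + E x| ≤
      B + max |E (θ - Real.pi)| |E (θ + Real.pi)| := fun x hx =>
    (abs_add_le _ _).trans (add_le_add (hB x hx) (abs_le_max_abs_abs (hE hx.1) (hE hx.2)))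
  filter_upwards [eventually_sub_le_stieltjesIntegral_poissonKer
    (fun a b => (hFint a b).add (hEint a b)) hbound hy hη, Ico_mem_nhdsLT one_pos]
    with r hr ⟨hr0, hr1⟩
  rw [stieltjesIntegral_add (hFint _ _) (hEint _ _) (contDiff_poissonKer_sub hr0 hr1 θ),
    ← poissonStieltjes_eq_stieltjesIntegral_period hFint hFT hr0 hr1 θ] at hr
  exact hr.trans (add_le_add_right (stieltjesIntegral_le_poissonStieltjes_foldPeriod hE hr0 hr1
    (by linarith [hθ.1]) (by linarith [hθ.2])) _)

theorem eventually_neg_poissonStieltjes_le_div_sq (hF : Continuous F) {ε : ℝ} (hε : 0 < ε) :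
    ∀ᶠ r : ℝ in 𝓝[<] 1, ∀ θ : ℝ,
      -poissonStieltjes F (r * Complex.exp (θ * Complex.I)) ≤ ε / (1 - r) ^ 2 := by
  obtain ⟨B, hB⟩ := isCompact_Icc.exists_bound_of_continuousOn
    (hF.continuousOn (s := Icc 0 (2 * Real.pi)))
  have hsmall : ∀ᶠ r : ℝ in 𝓝[<] 1, 2 * B * (1 - r) < ε := by
    have hcont : ContinuousAt (fun r : ℝ => 2 * B * (1 - r)) 1 := by fun_prop
    refine (hcont.tendsto.mono_left nhdsWithin_le_nhds).eventually_lt_const ?_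
    simpa using hε
  filter_upwards [hsmall, Ico_mem_nhdsLT one_pos] with r hr ⟨hr0, hr1⟩ θ
  have _ : 0 < 1 - r := sub_pos.2 hr1
  rw [poissonStieltjes_polar]
  calc _ ≤ 2 * B / (1 - r) :=
        (neg_le_abs _).trans (abs_stieltjesIntegral_poissonKer_le hr0 hr1 θ hB)
    _ = 2 * B * (1 - r) / (1 - r) ^ 2 := by field_simp
    _ ≤ ε / (1 - r) ^ 2 := by gcongr

variable {u : ℂ → ℝ} {z : ℂ}

theorem le_poissonStieltjes_add_foldPeriod (hu : ∀ z : ℂ, ‖z‖ < 1 → HarmonicAt u z)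
    (hgrowth : ∀ ε > 0, ∀ᶠ r in 𝓝[<] 1, ∀ θ, circleFun u r θ ≤ ε / (1 - r) ^ 2)
    (hrad : ∀ θ ∈ Ico (-Real.pi) Real.pi, ∀ η > 0, ∀ᶠ r in 𝓝[<] 1, circleFun u r θ ≤ f θ + η)
    (hF : Continuous F) (hFT : ∀ x, F (x + 2 * Real.pi) = F x + c) (hE : Monotone E)
    (hFE : ∀ θ ∈ Ico (-Real.pi) Real.pi, ∀ᶠ p in straddle θ,
      f θ * (p.2 - p.1) ≤ (F p.2 + E p.2) - (F p.1 + E p.1)) (hz : ‖z‖ < 1) :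
    u z ≤ poissonStieltjes F z + poissonStieltjes (foldPeriod E) z := by
  suffices u z - poissonStieltjes F z - poissonStieltjes (foldPeriod E) z ≤ 0 by linarith
  refine nonpos_of_forall_radial_limsup_nonpos
    (w := fun z => u z - poissonStieltjes F z - poissonStieltjes (foldPeriod E) z)
    (fun z hz => ((hu z hz).sub (harmonicAt_poissonStieltjes (hF.intervalIntegrable _ _) hz)).sub
      (harmonicAt_poissonStieltjes (monotone_foldPeriod hE).intervalIntegrable hz))
    (fun ε hε => ?_) (fun θ hθ η hη => ?_) hz
  · obtain ⟨ρ, hρ, hbound⟩ := (mem_nhdsLT_iff_exists_Ioo_subset).1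
      ((hgrowth _ (half_pos hε)).and ((eventually_neg_poissonStieltjes_le_div_sq hF
        (half_pos hε)).and (Ico_mem_nhdsLT one_pos)))
    refine ⟨ρ, hρ, fun z hρz hz => ?_⟩
    obtain ⟨huz, hFz, hr0, hr1⟩ := hbound ⟨hρz, hz⟩
    have huz := huz z.arg
    have hFz := hFz z.arg
    have hEz := poissonStieltjes_foldPeriod_nonneg hE hr0 hr1 z.arg
    rw [circleFun] at huz
    rw [Complex.norm_mul_exp_arg_mul_I] at huz hFz hEz
    linarith [add_halves (ε / (1 - ‖z‖) ^ 2), div_right_comm ε 2 ((1 - ‖z‖) ^ 2)]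
  · filter_upwards [hrad θ hθ _ (half_pos hη), eventually_sub_le_poissonStieltjes_add hF hFT hE hθ
      (hFE θ hθ) (half_pos hη)] with r hu hFE
    rw [circleFun] at hu
    linarith

theorem le_poissonStieltjes (hu : ∀ z : ℂ, ‖z‖ < 1 → HarmonicAt u z)
    (hgrowth : ∀ ε > 0, ∀ᶠ r in 𝓝[<] 1, ∀ θ, circleFun u r θ ≤ ε / (1 - r) ^ 2)
    (hrad : ∀ θ ∈ Ico (-Real.pi) Real.pi, ∀ η > 0, ∀ᶠ r in 𝓝[<] 1, circleFun u r θ ≤ f θ + η)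
    (hF : IsHKPrimitive f F) (hfT : Function.Periodic f (2 * Real.pi)) (hz : ‖z‖ < 1) :
    u z ≤ poissonStieltjes F z := by
  obtain ⟨c, hFT⟩ := hF.exists_add_period_eq hfT
  have hle : ∀ ε > 0, u z ≤ poissonStieltjes F z + poissonKer ‖z‖ 0 * ε := fun ε hε => by
    obtain ⟨E, hE, hEε, hFE⟩ := hF (-(2 * Real.pi)) (2 * Real.pi) (by linarith [Real.pi_pos]) ε hε
    have hcmp := le_poissonStieltjes_add_foldPeriod hu hgrowth hrad hF.continuous hFT hE
      (fun θ hθ => (hFE θ ⟨by linarith [hθ.1, Real.pi_pos], by linarith [hθ.2, Real.pi_pos]⟩).mono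
        fun p hp => by linarith [le_abs_self (f θ * (p.2 - p.1) - (F p.2 - F p.1))]) hz
    have hsmall := poissonStieltjes_foldPeriod_le hE (norm_nonneg z) hz z.arg
    rw [Complex.norm_mul_exp_arg_mul_I] at hsmall
    linarith [mul_le_mul_of_nonneg_left hEε (poissonKer_nonneg (norm_nonneg z) hz 0)]
  have hlim : Tendsto (fun ε => poissonStieltjes F z + poissonKer ‖z‖ 0 * ε) (𝓝[>] 0)
      (𝓝 (poissonStieltjes F z)) := by
    have hcont : Continuous fun ε => poissonStieltjes F z + poissonKer ‖z‖ 0 * ε := by fun_prop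
    simpa using (hcont.tendsto 0).mono_left nhdsWithin_le_nhds
  exact ge_of_tendsto hlim (eventually_mem_nhdsWithin.mono hle)

theorem eq_poissonStieltjes (hu : ∀ z : ℂ, ‖z‖ < 1 → HarmonicAt u z)
    (hgrowth : ∀ ε > 0, ∀ᶠ r in 𝓝[<] 1, ∀ θ, |circleFun u r θ| ≤ ε / (1 - r) ^ 2)
    (hlim : ∀ θ ∈ Ico (-Real.pi) Real.pi,
      Tendsto (fun r : ℝ => circleFun u r θ) (𝓝[<] 1) (𝓝 (f θ)))
    (hF : IsHKPrimitive f F) (hfT : Function.Periodic f (2 * Real.pi)) (hz : ‖z‖ < 1) :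
    u z = poissonStieltjes F z := by
  refine le_antisymm (le_poissonStieltjes hu (fun ε hε => (hgrowth ε hε).mono fun r hr θ =>
    (le_abs_self _).trans (hr θ)) (fun θ hθ η hη => (hlim θ hθ).eventually_le_const
      (lt_add_of_pos_right _ hη)) hF hfT hz) (neg_le_neg_iff.1 ?_)
  have hneg := le_poissonStieltjes (u := fun z => -u z) (fun z hz => (hu z hz).neg)
    (fun ε hε => (hgrowth ε hε).mono fun r hr θ => (neg_le_abs _).trans (hr θ))
    (fun θ hθ η hη => (hlim θ hθ).neg.eventually_le_const (lt_add_of_pos_right _ hη)) hF.neg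
    (fun x => by simp only [hfT x]) hz
  rwa [poissonStieltjes, stieltjesIntegral_neg] at hneg

theorem hkIntegrable_mul_poissonKer (hF : IsHKPrimitive f F) (hr0 : 0 ≤ r) (hr1 : r < 1) (θ : ℝ) :
    HKIntegrable (fun φ => f φ * poissonKer r (φ - θ)) (-Real.pi) Real.pi :=
  (hF.mul (contDiff_poissonKer_sub hr0 hr1 θ)).hkIntegrable (by linarith [Real.pi_pos])

theorem poissonInt_eq_poissonStieltjes (hF : IsHKPrimitive f F)
    (hfT : Function.Periodic f (2 * Real.pi)) (hr0 : 0 ≤ r) (hr1 : r < 1) (θ : ℝ) :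
    poissonInt f r θ = poissonStieltjes F (r * Complex.exp (θ * Complex.I)) := by
  obtain ⟨c, hFT⟩ := hF.exists_add_period_eq hfT
  have hg := contDiff_poissonKer_sub hr0 hr1 θ
  have hint : ∀ a b, IntervalIntegrable F volume a b := hF.continuous.intervalIntegrable
  rw [poissonInt, (hF.mul hg).hkIntegral_eq (by linarith [Real.pi_pos]),
    poissonStieltjes_eq_stieltjesIntegral_period hint hFT hr0 hr1 0, zero_sub, zero_add,
    sub_eq_iff_eq_add', stieltjesIntegral_add_adjacent (hint 0 _) (hint _ _) hg]

end comparison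

end HKDirichlet

end

theorem mainTheorem4_general (u : ℂ → ℝ) (f : ℝ → ℝ)
    (hu : InnerProductSpace.HarmonicOnNhd u (Metric.ball (0 : ℂ) 1))
    (hfT : Function.Periodic f (2 * Real.pi))
    (hf : ∀ a b : ℝ, a < b → HKDirichlet.HKIntegrable f a b)
    (hlim : ∀ θ ∈ Set.Ico (-Real.pi) Real.pi,
      Tendsto (fun r : ℝ => HKDirichlet.circleFun u r θ) (𝓝[<] 1) (𝓝 (f θ)))
    (hgrowth : ∀ ε > 0, ∀ᶠ r in 𝓝[<] 1, ∀ θ, |HKDirichlet.circleFun u r θ| ≤ ε / (1 - r) ^ 2) :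
    ∀ r θ : ℝ, 0 ≤ r → r < 1 →
      HKDirichlet.HKIntegrable (fun φ => f φ * HKDirichlet.poissonKer r (φ - θ))
        (-Real.pi) Real.pi ∧
      HKDirichlet.circleFun u r θ = HKDirichlet.poissonInt f r θ := by
  intro r θ hr0 hr1
  have hF := HKDirichlet.isHKPrimitive_hkPrimitive hf
  have hz : ‖(r : ℂ) * Complex.exp (θ * Complex.I)‖ < 1 := by
    rwa [norm_mul, Complex.norm_exp_ofReal_mul_I, mul_one, Complex.norm_of_nonneg hr0]
  refine ⟨HKDirichlet.hkIntegrable_mul_poissonKer hF hr0 hr1 θ, ?_⟩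
  rw [HKDirichlet.poissonInt_eq_poissonStieltjes hF hfT hr0 hr1]
  exact HKDirichlet.eq_poissonStieltjes (fun z hz => hu z (mem_ball_zero_iff.2 hz))
    hgrowth hlim hF hfT hz

theorem mainTheorem4 (u : ℂ → ℝ) (f : ℝ → ℝ)
    (hu : InnerProductSpace.HarmonicOnNhd u (Metric.ball (0 : ℂ) 1))
    (hf : HKDirichlet.MemHK f)
    (hlim : ∀ θ ∈ Set.Ico (-Real.pi) Real.pi,
      Tendsto (fun r : ℝ => HKDirichlet.circleFun u r θ) (𝓝[<] 1) (𝓝 (f θ)))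
    (hgrowth : Tendsto
      (fun r : ℝ => ENNReal.ofReal (1 - r) *
        HKDirichlet.alexiewiczNorm (HKDirichlet.circleFun u r)) (𝓝[<] 1) (𝓝 0)) :
    ∀ r θ : ℝ, 0 ≤ r → r < 1 →
      HKDirichlet.HKIntegrable (fun φ => f φ * HKDirichlet.poissonKer r (φ - θ))
        (-Real.pi) Real.pi ∧
      HKDirichlet.circleFun u r θ = HKDirichlet.poissonInt f r θ := by
  exact mainTheorem4_general u f hu hf.periodic hf.integrable hlim fun _ hε =>
    HKDirichlet.eventually_abs_circleFun_le_div_sq hu hgrowth hε
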